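/- Let $M=2^\lambda$ with $\lambda\ge 2$, and let $\mathcal S=\{e^{j(2k+1)\pi/M}: 0\le k\le M-1\}$ be the $M$-PSK signal set. A clustering is given by a map $\mathcal M:\mathcal S\times\mathcal S\to\mathbb C$ (its clusters are the nonempty fibres of $\mathcal M$). It satisfies the exclusive law if $\mathcal M(x_A,x_B)\ne\mathcal M(x_A',x_B)$ whenever $x_A\neq x_A'$, and $\mathcal M(x_A,x_B)\neq\mathcal M(x_A,x_B')$ whenever $x_B\ne x_B'$. Its minimum cluster distance at the fade state $z=\gamma e^{j\theta}\in\mathbb C$ ($\gamma=|z|$) is $$\min\{|(x_A-x_A')+z(x_B-x_B')| : \mathcal M(x_A,x_B)\neq\mathcal M(x_A',x_B')\}.$$ The singularity-free region $\Gamma_{SF}$ is the set of all $z\in\mathbb C$ at which every clustering satisfying the exclusive law has the same minimum cluster distance $\min(2\sin(\pi/M),\,2\gamma\sin(\pi/M))$. For a set of circles, the outer envelope region is the exterior of their outer envelope, boundary included: the closure of the union of the unbounded connected components of the complement of the union of the circles. For a point $p$ and a set of circles and straight lines, the inner envelope region is the closure of the connected component containing $p$ of the complement of the union of these curves. Region I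 is the outer envelope region of the $2M$ unit circles with centers $\cot(\pi/M)e^{j2k\pi/M}$ and $\operatorname{cosec}(\pi/M)e^{j(2k+1)\pi/M}$, $0\le k\le M-1$. Region II is, for $M>4$, the inner envelope region formed by the origin and the $2M$ circles consisting of the $M$ circles with centers $\sec(\pi/M)\tan(\pi/M)e^{j(2k+1)\pi/M}$ and radius $\tan^2(\pi/M)$ and the $M$ circles with centers $\tfrac12\tan(2\pi/M)e^{j2k\pi/M}$ and radius $\tfrac12\tan(\pi/M)\tan(2\pi/M)$, $0\le k\le M-1$. For $M=4$ it is the inner envelope region formed by the origin, the four unit circles with centers $\sqrt2\,e^{j(2k+1)\pi/4}$, $0\le k\le 3$, and the four straight lines $\operatorname{Re}z=\pm\tfrac12$, $\operatorname{Im}z=\pm\tfrac12$. Then: 1. $\Gamma_{SF}=\text{Region I}\cup\text{Region II}$. 2. If $L$ denotes the set of all $z\in\mathbb C$ at which all clusterings satisfying the exclusive law have one common minimum cluster distance (whatever its value), then $\overline{\operatorname{int}L}=\text{Region I}\cup\text{Region II}$. 3. Region II is the image of Region I under $z\mapsto 1/z$, together with the origin (the image of $\infty$). -/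

import Mathlib

open Complex (exp I)

noncomputable section

/-- The symmetric `M`-PSK signal set: the points `e^{j(2k+1)π/M}`, `0 ≤ k ≤ M - 1`. -/
def psk (M : ℕ) : Set ℂ :=
  {s | ∃ k : ℕ, k < M ∧ s = exp (((2 * k + 1) * Real.pi / M : ℝ) * I)}

/-- A relay map assigns to each pair `(x_A, x_B)` of transmitted points a complex number; its
fibres are the clusters of a clustering. -/
abbrev RelayMap (M : ℕ) : Type := psk M × psk M → ℂ

/-- The exclusive law: pairs which agree in exactly one of the two entries are mapped to different
complex numbers. -/
def ExclusiveLaw {M : ℕ} (N : RelayMap M) : Prop :=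
  (∀ xA xA' xB : psk M, xA ≠ xA' → N (xA, xB) ≠ N (xA', xB)) ∧
    (∀ xA xB xB' : psk M, xB ≠ xB' → N (xA, xB) ≠ N (xA, xB'))

/-- The distances, at the fade state `z = γ e^{jθ}`, between points
`x_A + z x_B` and `x_A' + z x_B'` that belong to different clusters. -/
def interClusterDistances {M : ℕ} (N : RelayMap M) (z : ℂ) : Set ℝ :=
  {d | ∃ p q : psk M × psk M, N p ≠ N q ∧
    d = ‖((p.1 : ℂ) - (q.1 : ℂ)) + z * ((p.2 : ℂ) - (q.2 : ℂ))‖}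

/-- `d` is the minimum cluster distance of the clustering given by `N` at the fade state `z`. -/
def IsMinClusterDistance {M : ℕ} (N : RelayMap M) (z : ℂ) (d : ℝ) : Prop :=
  IsLeast (interClusterDistances N z) d

/-- The fade states at which all clusterings satisfying the exclusive law have one and the same
minimum cluster distance. -/
def clusteringIndependentSet (M : ℕ) : Set ℂ :=
  {z | ∃ d : ℝ, ∀ N : RelayMap M, ExclusiveLaw N → IsMinClusterDistance N z d}

/-- The singularity-free region: the fade states `z = γ e^{jθ}` at which every clustering satisfying
the exclusive law has the same minimum cluster distance `min (2 sin (π/M)) (2 γ sin (π/M))`, the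
smaller of the minimum distances of the signal sets `S` and `z S`. -/
def singularityFreeRegion (M : ℕ) : Set ℂ :=
  {z | ∀ N : RelayMap M, ExclusiveLaw N →
    IsMinClusterDistance N z
      (min (2 * Real.sin (Real.pi / M)) (2 * ‖z‖ * Real.sin (Real.pi / M)))}

/-- The outer envelope region formed by a set of curves: the exterior (the unbounded part of the
complement of the curves), together with its boundary. -/
def outerEnvelopeRegion (C : Set (Set ℂ)) : Set ℂ :=
  closure {z | z ∈ (⋃₀ C)ᶜ ∧ ¬ Bornology.IsBounded (connectedComponentIn (⋃₀ C)ᶜ z)}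

/-- The inner envelope region formed by a point and a set of curves: the component of the
complement of the curves that contains the point, together with its boundary. -/
def innerEnvelopeRegion (p : ℂ) (C : Set (Set ℂ)) : Set ℂ :=
  closure (connectedComponentIn (⋃₀ C)ᶜ p)

/-- The unit complex number `e^{j2kπ/M}`. -/
def evenDir (M k : ℕ) : ℂ := exp ((2 * k * Real.pi / M : ℝ) * I)

/-- The unit complex number `e^{j(2k+1)π/M}`. -/
def oddDir (M k : ℕ) : ℂ := exp (((2 * k + 1) * Real.pi / M : ℝ) * I)

/-- The `2M` unit circles centred at `cot (π/M) e^{j2kπ/M}` and `cosec (π/M) e^{j(2k+1)π/M}`. -/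
def outerCircles (M : ℕ) : Set (Set ℂ) :=
  {C | ∃ k : ℕ, k < M ∧
    (C = Metric.sphere ((Real.cot (Real.pi / M) : ℂ) * evenDir M k) 1 ∨
      C = Metric.sphere (((1 / Real.sin (Real.pi / M) : ℝ) : ℂ) * oddDir M k) 1)}

/-- Region I. -/
def regionI (M : ℕ) : Set ℂ := outerEnvelopeRegion (outerCircles M)

/-- For `M > 4`: the `M` circles centred at `sec (π/M) tan (π/M) e^{j(2k+1)π/M}` of radius
`tan² (π/M)` and the `M` circles centred at `(1/2) tan (2π/M) e^{j2kπ/M}` of radius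
`(1/2) tan (π/M) tan (2π/M)`. -/
def innerCircles (M : ℕ) : Set (Set ℂ) :=
  {C | ∃ k : ℕ, k < M ∧
    (C = Metric.sphere
        (((1 / Real.cos (Real.pi / M) * Real.tan (Real.pi / M) : ℝ) : ℂ) * oddDir M k)
        (Real.tan (Real.pi / M) ^ 2) ∨
      C = Metric.sphere
        (((1 / 2 * Real.tan (2 * Real.pi / M) : ℝ) : ℂ) * evenDir M k)
        (1 / 2 * Real.tan (Real.pi / M) * Real.tan (2 * Real.pi / M)))}

/-- For `M = 4`: the four unit circles centred at `√2 e^{j(2k+1)π/4}` and the four straight lines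
`Re z = ±1/2`, `Im z = ±1/2`. -/
def innerCurvesFour : Set (Set ℂ) :=
  {C | ∃ k : ℕ, k < 4 ∧ C = Metric.sphere (((Real.sqrt 2 : ℝ) : ℂ) * oddDir 4 k) 1} ∪
    {{z : ℂ | z.re = 1 / 2}, {z : ℂ | z.re = -(1 / 2)},
      {z : ℂ | z.im = 1 / 2}, {z : ℂ | z.im = -(1 / 2)}}

/-- Region II (for `M = 4` and for `M > 4`). -/
def regionII (M : ℕ) : Set ℂ :=
  innerEnvelopeRegion 0 (if M = 4 then innerCurvesFour else innerCircles M)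

end

/-! Everything reduces to `separatedSet`: the fade states at which no nontrivial pair of signal
differences makes `‖a + z * b‖` smaller than `2 sin(π/M) min(1, |z|)`. An injective clustering sees
all these distances. Conversely, the exclusive law always leaves the pairs sharing one entry in
different clusters, and these attain the bound. Hence `singularityFreeRegion_eq_separatedSet`.

Differences have the form `2 sin(mπ/M) e^{jkπ/M}` with `m + k` odd. Dividing by `b` turns separation
into a family of discs that `z` must avoid. For `|z| ≥ 1` only the discs from the shortest `b`
matter. They cover the annulus up to radius `cosec(π/M)` (`exists_norm_sub_lt_one`), and beyond it
only the outermost centre of each direction counts (`one_le_norm_sub_of_mem_outerClosed`). This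
gives `mem_outerClosed_iff`. Interchanging `a` and `b` is inversion in `z`, which handles `|z| ≤ 1`.

Topologically, `outerClosed` is stable under radial expansion, and the circle of radius `cosec(π/M)`
lies in the union of the open discs. So the unbounded components make up `outerOpen` (`regionI_eq`);
inverting the circles gives `regionII_eq`.

For the interior of the clustering-independent set, suppose some open part of it is not separated.
At a generic point there, the minimum over all pairs is attained by some `(a, b)` with both entries
nonzero. The clustering that merges exactly the pairs coinciding at the fade state `-a/b` has its
minimum at a non-proportional pair, and generically that distance is different. -/

noncomputable section

/-! ### Directions `e^{jkπ/M}` and differences of signal points -/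

/-- The direction `e^{jkπ/M}`. -/
def dir (M : ℕ) (k : ℤ) : ℂ := exp (((k : ℝ) * (Real.pi / M) : ℝ) * I)

lemma norm_dir (M : ℕ) (k : ℤ) : ‖dir M k‖ = 1 := Complex.norm_exp_ofReal_mul_I _

lemma dir_ne_zero (M : ℕ) (k : ℤ) : dir M k ≠ 0 := Complex.exp_ne_zero _

lemma dir_add (M : ℕ) (k l : ℤ) : dir M (k + l) = dir M k * dir M l := by
  unfold dir
  rw [← Complex.exp_add]
  congr 1
  push_cast
  ring

lemma dir_add_card {M : ℕ} (hM : 0 < M) (k : ℤ) : dir M (k + M) = -dir M k := by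
  have hM' : (M : ℝ) ≠ 0 := by positivity
  rw [dir_add]
  have : dir M (M : ℤ) = -1 := by
    unfold dir
    have : (((M : ℤ) : ℝ) * (Real.pi / M) : ℝ) = Real.pi := by
      push_cast
      field_simp
    rw [this, Complex.exp_pi_mul_I]
  rw [this]
  ring

lemma dir_neg (M : ℕ) (k : ℤ) : dir M (-k) = (dir M k)⁻¹ := by
  unfold dir
  rw [← Complex.exp_neg]
  congr 1
  push_cast
  ring

lemma dir_zero (M : ℕ) : dir M 0 = 1 := by simp [dir]

lemma dir_add_two_mul_card_mul {M : ℕ} (hM : 0 < M) (k j : ℤ) :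
    dir M (k + 2 * M * j) = dir M k := by
  rw [dir_add]
  have : dir M (2 * M * j) = 1 := by
    unfold dir
    rw [Complex.exp_eq_one_iff]
    refine ⟨j, ?_⟩
    have hM'' : (M : ℂ) ≠ 0 := by exact_mod_cast hM.ne'
    push_cast
    field_simp
  rw [this, mul_one]

lemma evenDir_eq_dir (M k : ℕ) : evenDir M k = dir M (2 * k) := by
  unfold evenDir dir
  congr 3
  push_cast
  ring

lemma oddDir_eq_dir (M k : ℕ) : oddDir M k = dir M (2 * k + 1) := by
  unfold oddDir dir
  congr 3
  push_cast
  ring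

lemma exists_evenDir_eq {M : ℕ} (hM : 0 < M) {k : ℤ} (hk : Even k) :
    ∃ j : ℕ, j < M ∧ dir M k = evenDir M j := by
  obtain ⟨r, rfl⟩ := hk
  have hM' : (0 : ℤ) < M := by exact_mod_cast hM
  have h0 := Int.emod_nonneg r hM'.ne'
  have h1 := Int.emod_lt_of_pos r hM'
  refine ⟨(r % M).toNat, by omega, ?_⟩
  rw [evenDir_eq_dir, Int.toNat_of_nonneg h0,
    ← dir_add_two_mul_card_mul hM (2 * (r % M)) (r / M)]
  congr 1
  linarith [Int.emod_add_mul_ediv r M]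

lemma exists_oddDir_eq {M : ℕ} (hM : 0 < M) {k : ℤ} (hk : Odd k) :
    ∃ j : ℕ, j < M ∧ dir M k = oddDir M j := by
  obtain ⟨r, rfl⟩ := hk
  have hM' : (0 : ℤ) < M := by exact_mod_cast hM
  have h0 := Int.emod_nonneg r hM'.ne'
  have h1 := Int.emod_lt_of_pos r hM'
  refine ⟨(r % M).toNat, by omega, ?_⟩
  rw [oddDir_eq_dir, Int.toNat_of_nonneg h0,
    ← dir_add_two_mul_card_mul hM (2 * (r % M) + 1) (r / M)]
  congr 1
  linarith [Int.emod_add_mul_ediv r M]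

lemma mem_psk_iff {M : ℕ} (hM : 0 < M) {s : ℂ} :
    s ∈ psk M ↔ ∃ p : ℤ, s = dir M (2 * p + 1) := by
  constructor
  · rintro ⟨k, -, rfl⟩
    exact ⟨k, oddDir_eq_dir M k⟩
  · rintro ⟨p, rfl⟩
    obtain ⟨j, hj, h⟩ := exists_oddDir_eq hM (k := 2 * p + 1) ⟨p, rfl⟩
    exact ⟨j, hj, h⟩

lemma finite_psk (M : ℕ) : (psk M).Finite := by
  refine ((Set.finite_lt_nat M).image (oddDir M)).subset ?_
  rintro s ⟨k, hk, rfl⟩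
  exact ⟨k, hk, rfl⟩

/-- The differences of two points of the `M`-PSK signal set. -/
def pskDiffs (M : ℕ) : Set ℂ := {d | ∃ x ∈ psk M, ∃ y ∈ psk M, d = x - y}

lemma dir_half {M q : ℕ} (hq : M = 4 * q) (hM : 0 < M) : dir M (2 * q) = I := by
  have hq' : (q : ℝ) ≠ 0 := by
    have : 0 < q := by omega
    positivity
  unfold dir
  have : (((2 * q : ℤ) : ℝ) * (Real.pi / M) : ℝ) = Real.pi / 2 := by
    rw [hq]
    push_cast
    field_simp
    norm_num
  rw [this]
  push_cast
  exact Complex.exp_pi_div_two_mul_I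

/-- Sum-to-product for a chord of the unit circle; the index shift `2 * q` is the factor `I`. -/
lemma dir_sub_dir {M q : ℕ} (hq : M = 4 * q) (hM : 0 < M) (a b : ℤ) :
    dir M (2 * a + 1) - dir M (2 * b + 1) =
      ((2 * Real.sin (((a - b : ℤ) : ℝ) * (Real.pi / M)) : ℝ) : ℂ) * dir M (a + b + 1 + 2 * q) := by
  rw [dir_add M (a + b + 1), dir_half hq hM]
  unfold dir
  push_cast
  rw [Complex.sin]
  have h1 : exp (((2 * a + 1 : ℂ) * (Real.pi / M)) * I) =
      exp ((a - b) * (Real.pi / M) * I) * exp ((a + b + 1) * (Real.pi / M) * I) := by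
    rw [← Complex.exp_add]; congr 1; ring
  have h2 : exp (((2 * b + 1 : ℂ) * (Real.pi / M)) * I) =
      exp (-((a - b) * (Real.pi / M)) * I) * exp ((a + b + 1) * (Real.pi / M) * I) := by
    rw [← Complex.exp_add]; congr 1; ring
  rw [h1, h2]
  linear_combination (exp ((a - b) * (Real.pi / M) * I) - exp (-((a - b) * (Real.pi / M)) * I)) *
    exp ((a + b + 1) * (Real.pi / M) * I) * Complex.I_mul_I

/-- The parity condition arises because `a - b` and `a + b + 1` have opposite parity, while the
quarter turn `2 * q` is even. -/
lemma mem_pskDiffs_iff {M : ℕ} (h4 : 4 ∣ M) (hM : 0 < M) {d : ℂ} :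
    d ∈ pskDiffs M ↔ ∃ m k : ℤ, Odd (m + k) ∧
      d = ((2 * Real.sin ((m : ℝ) * (Real.pi / M)) : ℝ) : ℂ) * dir M k := by
  obtain ⟨q, hq⟩ := h4
  constructor
  · rintro ⟨x, hx, y, hy, rfl⟩
    obtain ⟨a, rfl⟩ := (mem_psk_iff hM).1 hx
    obtain ⟨b, rfl⟩ := (mem_psk_iff hM).1 hy
    exact ⟨a - b, a + b + 1 + 2 * q, ⟨a + q, by ring⟩, dir_sub_dir hq hM a b⟩
  · rintro ⟨m, k, ⟨r, hr⟩, rfl⟩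
    refine ⟨_, (mem_psk_iff hM).2 ⟨r - q, rfl⟩, _, (mem_psk_iff hM).2 ⟨r - q - m, rfl⟩, ?_⟩
    rw [dir_sub_dir hq hM]
    congr 4
    · ring_nf
    · linarith

/-! ### Sines of integer multiples of `π/M` -/

lemma sin_le_sin_of_mem {a x : ℝ} (ha : 0 ≤ a) (hax : a ≤ x) (hx : x ≤ Real.pi - a) :
    Real.sin a ≤ Real.sin x := by
  rcases le_total x (Real.pi / 2) with h | h
  · exact Real.sin_le_sin_of_le_of_le_pi_div_two (by linarith [Real.pi_pos]) h hax
  · rw [← Real.sin_pi_sub x]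
    exact Real.sin_le_sin_of_le_of_le_pi_div_two (by linarith [Real.pi_pos]) (by linarith)
      (by linarith)

lemma abs_sin_int_emod {N : ℕ} (hN : 0 < N) (p : ℤ) :
    |Real.sin ((p : ℝ) * (Real.pi / N))| = |Real.sin (((p % N : ℤ) : ℝ) * (Real.pi / N))| := by
  have hN' : (N : ℝ) ≠ 0 := by positivity
  have h : (p : ℝ) * (Real.pi / N) =
      ((p % N : ℤ) : ℝ) * (Real.pi / N) + ((p / N : ℤ) : ℝ) * Real.pi := by
    have : (p : ℝ) = ((p % N : ℤ) : ℝ) + N * ((p / N : ℤ) : ℝ) := by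
      exact_mod_cast (Int.emod_add_mul_ediv p N).symm
    conv_lhs => rw [this]
    field_simp
  rw [h, Real.sin_add_int_mul_pi, abs_mul, abs_zpow]
  simp

lemma sin_le_abs_sin_of_emod {N : ℕ} (hN : 0 < N) {j : ℕ} {p : ℤ} (h1 : (j : ℤ) ≤ p % N)
    (h2 : p % N ≤ N - j) :
    Real.sin (j * (Real.pi / N)) ≤ |Real.sin ((p : ℝ) * (Real.pi / N))| := by
  have hN' : (0 : ℝ) < N := by positivity
  have hp : 0 < Real.pi / N := by positivity
  rw [abs_sin_int_emod hN]
  refine le_trans (sin_le_sin_of_mem (by positivity) ?_ ?_) (le_abs_self _)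
  · gcongr
    exact_mod_cast h1
  · have : ((p % N : ℤ) : ℝ) ≤ N - j := by exact_mod_cast h2
    calc ((p % N : ℤ) : ℝ) * (Real.pi / N) ≤ (N - j) * (Real.pi / N) := by gcongr
      _ = Real.pi - j * (Real.pi / N) := by field_simp

lemma sin_le_abs_sin_of_not_dvd {N : ℕ} (hN : 0 < N) {p : ℤ} (h : ¬ (N : ℤ) ∣ p) :
    Real.sin (Real.pi / N) ≤ |Real.sin ((p : ℝ) * (Real.pi / N))| := by
  have hN' : (0 : ℤ) < N := by exact_mod_cast hN
  have h0 := Int.emod_nonneg p hN'.ne'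
  have h1 := Int.emod_lt_of_pos p hN'
  have h2 : p % N ≠ 0 := fun h' => h (Int.dvd_of_emod_eq_zero h')
  simpa using sin_le_abs_sin_of_emod hN (j := 1) (p := p) (by push_cast; omega)
    (by push_cast; omega)

section angle
variable {M : ℕ}

lemma angle_pos (hM : 0 < M) : 0 < Real.pi / M := by positivity

lemma angle_le (hM : 4 ≤ M) : Real.pi / M ≤ Real.pi / 4 := by
  have : (4 : ℝ) ≤ M := by exact_mod_cast hM
  gcongr

lemma sin_angle_pos (hM : 4 ≤ M) : 0 < Real.sin (Real.pi / M) :=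
  Real.sin_pos_of_pos_of_lt_pi (angle_pos (by omega)) (by linarith [angle_le hM, Real.pi_pos])

lemma cos_angle_pos (hM : 4 ≤ M) : 0 < Real.cos (Real.pi / M) :=
  Real.cos_pos_of_mem_Ioo ⟨by linarith [angle_pos (M := M) (by omega), Real.pi_pos],
    by linarith [angle_le hM, Real.pi_pos]⟩

lemma cos_two_angle_nonneg (hM : 4 ≤ M) : 0 ≤ Real.cos (2 * (Real.pi / M)) :=
  Real.cos_nonneg_of_mem_Icc ⟨by linarith [angle_pos (M := M) (by omega), Real.pi_pos],
    by linarith [angle_le hM]⟩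

/-- Passing to the complementary angle turns lower bounds for sines into upper bounds. -/
lemma exists_sin_sq_eq_one_sub_sin_sq (h4 : 4 ∣ M) (hM : 4 ≤ M) (m : ℤ) :
    ∃ q : ℕ, M = 4 * q ∧ Real.sin ((m : ℝ) * (Real.pi / M)) ^ 2 =
      1 - Real.sin (((2 * q - m : ℤ) : ℝ) * (Real.pi / M)) ^ 2 := by
  obtain ⟨q, hq⟩ := h4
  refine ⟨q, hq, ?_⟩
  have hq' : (q : ℝ) ≠ 0 := by
    have : 0 < q := by omega
    positivity
  have : ((2 * q - m : ℤ) : ℝ) * (Real.pi / M) = Real.pi / 2 - m * (Real.pi / M) := by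
    rw [hq]
    push_cast
    field_simp
    ring
  rw [this, Real.sin_pi_div_two_sub]
  linarith [Real.sin_sq_add_cos_sq ((m : ℝ) * (Real.pi / M))]

lemma abs_sin_le_cos_of_odd (h4 : 4 ∣ M) (hM : 4 ≤ M) {m : ℤ} (hm : Odd m) :
    |Real.sin ((m : ℝ) * (Real.pi / M))| ≤ Real.cos (Real.pi / M) := by
  obtain ⟨q, hq, h⟩ := exists_sin_sq_eq_one_sub_sin_sq h4 hM m
  have hnd : ¬ (M : ℤ) ∣ 2 * q - m := by
    rintro ⟨r, hr⟩
    obtain ⟨s, rfl⟩ := hm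
    have : (M : ℤ) = 4 * q := by exact_mod_cast hq
    rw [this, mul_assoc] at hr
    omega
  have h1 := sin_le_abs_sin_of_not_dvd (by omega : 0 < M) hnd
  have h2 := pow_le_pow_left₀ (sin_angle_pos hM).le h1 2
  rw [sq_abs] at h2
  refine abs_le_of_sq_le_sq ?_ (cos_angle_pos hM).le
  nlinarith [Real.sin_sq_add_cos_sq (Real.pi / M)]

/-- The complementary angle is a multiple of `π/(M/2)`, so its sine is either zero or at least
`sin(2π/M)` in absolute value. -/
lemma abs_sin_le_cos_two_of_even (h4 : 4 ∣ M) (hM : 4 ≤ M) {m : ℤ} (hm : Even m) :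
    |Real.sin ((m : ℝ) * (Real.pi / M))| = 1 ∨
      |Real.sin ((m : ℝ) * (Real.pi / M))| ≤ Real.cos (2 * (Real.pi / M)) := by
  obtain ⟨q, hq, h⟩ := exists_sin_sq_eq_one_sub_sin_sq h4 hM m
  obtain ⟨r, rfl⟩ := hm
  have hq0 : 0 < q := by omega
  have hq' : (q : ℝ) ≠ 0 := by positivity
  have e : ((2 * q - (r + r) : ℤ) : ℝ) * (Real.pi / M) =
      ((q - r : ℤ) : ℝ) * (Real.pi / ((2 * q : ℕ) : ℝ)) := by
    rw [hq]
    push_cast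
    field_simp
    ring
  have e2 : Real.pi / ((2 * q : ℕ) : ℝ) = 2 * (Real.pi / M) := by
    rw [hq]
    push_cast
    field_simp
    ring
  by_cases hd : ((2 * q : ℕ) : ℤ) ∣ q - r
  · left
    obtain ⟨s, hs⟩ := hd
    have : Real.sin (((2 * q - (r + r) : ℤ) : ℝ) * (Real.pi / M)) = 0 := by
      rw [e, hs]
      have : ((((2 * q : ℕ) : ℤ) * s : ℤ) : ℝ) * (Real.pi / ((2 * q : ℕ) : ℝ)) = s * Real.pi := by
        push_cast
        field_simp
      rw [this, Real.sin_int_mul_pi]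
    rw [this] at h
    rw [← sq_eq_sq₀ (abs_nonneg _) zero_le_one, sq_abs, h]
    norm_num
  · right
    have h1 := sin_le_abs_sin_of_not_dvd (by omega : 0 < 2 * q) hd
    rw [← e, e2] at h1
    have hs : 0 ≤ Real.sin (2 * (Real.pi / M)) :=
      Real.sin_nonneg_of_nonneg_of_le_pi (by positivity) (by linarith [angle_le hM, Real.pi_pos])
    have h2 := pow_le_pow_left₀ hs h1 2
    rw [sq_abs] at h2
    refine abs_le_of_sq_le_sq ?_ (cos_two_angle_nonneg hM)
    nlinarith [Real.sin_sq_add_cos_sq (2 * (Real.pi / M))]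

lemma abs_sin_angle_cases (hM : 4 ≤ M) (n : ℤ) :
    Real.sin ((n : ℝ) * (Real.pi / M)) = 0 ∨
      (∃ j : ℤ, n = 1 + M * j ∨ n = -1 + M * j) ∨
      Real.sin (2 * (Real.pi / M)) ≤ |Real.sin ((n : ℝ) * (Real.pi / M))| := by
  have hM' : (0 : ℤ) < M := by omega
  have h0 := Int.emod_nonneg n hM'.ne'
  have h1 := Int.emod_lt_of_pos n hM'
  have h2 := Int.emod_add_mul_ediv n M
  by_cases c0 : n % M = 0
  · left
    rw [← abs_eq_zero, abs_sin_int_emod (by omega), c0]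
    simp
  by_cases c1 : n % M = 1
  · exact Or.inr (Or.inl ⟨n / M, Or.inl (by omega)⟩)
  by_cases c2 : n % M = M - 1
  · exact Or.inr (Or.inl ⟨n / M + 1, Or.inr (by rw [mul_add]; omega)⟩)
  · exact Or.inr (Or.inr (sin_le_abs_sin_of_emod (by omega) (j := 2) (by push_cast; omega)
      (by push_cast; omega)))

end angle

/-! ### Distances to points on the rays, and the nearest ray -/

lemma norm_sub_mul_dir_sq (M : ℕ) (z : ℂ) (t : ℝ) (k : ℤ) :
    ‖z - t * dir M k‖ ^ 2 =
      ‖z‖ ^ 2 + t ^ 2 - 2 * t * ‖z‖ * Real.cos (z.arg - k * (Real.pi / M)) := by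
  have hd : dir M k = Real.cos (k * (Real.pi / M)) + Real.sin (k * (Real.pi / M)) * I := by
    unfold dir
    rw [Complex.exp_mul_I, ← Complex.ofReal_cos, ← Complex.ofReal_sin]
  have hre := Complex.norm_mul_cos_arg z
  have him := Complex.norm_mul_sin_arg z
  have hn : ‖z‖ ^ 2 = z.re ^ 2 + z.im ^ 2 := by
    rw [Complex.sq_norm, Complex.normSq_apply]; ring
  rw [Complex.sq_norm, Complex.normSq_apply, hd, Real.cos_sub, hn]
  have h1 : 2 * t * ‖z‖ * (Real.cos z.arg * Real.cos (k * (Real.pi / M)) +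
      Real.sin z.arg * Real.sin (k * (Real.pi / M))) =
      2 * t * (z.re * Real.cos (k * (Real.pi / M)) + z.im * Real.sin (k * (Real.pi / M))) := by
    rw [← hre, ← him]; ring
  rw [h1]
  simp only [Complex.sub_re, Complex.sub_im, Complex.mul_re, Complex.mul_im, Complex.add_re,
    Complex.add_im, Complex.ofReal_re, Complex.ofReal_im, Complex.I_re, Complex.I_im]
  linear_combination t ^ 2 * Real.sin_sq_add_cos_sq (k * (Real.pi / M))

lemma exists_dir_near {M : ℕ} (hM : 0 < M) (φ : ℝ) (b : ℤ) :
    ∃ j : ℤ, |φ - ((2 * j + b : ℤ) : ℝ) * (Real.pi / M)| ≤ Real.pi / M := by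
  have ht := angle_pos hM
  set t := Real.pi / M
  refine ⟨round ((φ / t - b) / 2), ?_⟩
  have h := abs_sub_round ((φ / t - b) / 2)
  have e : φ - ((2 * round ((φ / t - b) / 2) + b : ℤ) : ℝ) * t =
      2 * t * ((φ / t - b) / 2 - round ((φ / t - b) / 2)) := by
    push_cast
    field_simp
    ring
  rw [e, abs_mul, abs_of_pos (by positivity)]
  nlinarith

lemma cos_angle_le_of_abs_le {M : ℕ} (hM : 4 ≤ M) {x : ℝ} (h : |x| ≤ Real.pi / M) :
    Real.cos (Real.pi / M) ≤ Real.cos x := by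
  rw [← Real.cos_abs x]
  exact Real.cos_le_cos_of_nonneg_of_le_pi (abs_nonneg _)
    (by linarith [angle_le hM, Real.pi_pos]) h

/-- Maximality over all directions of one parity is needed as well as the angular bound: the disc
condition is applied at the best direction and then transferred to an arbitrary one. -/
lemma exists_dir_nearest {M : ℕ} (hM : 4 ≤ M) (φ : ℝ) (b : ℤ) :
    ∃ j : ℤ, Real.cos (Real.pi / M) ≤ Real.cos (φ - ((2 * j + b : ℤ) : ℝ) * (Real.pi / M)) ∧
      ∀ i : ℤ, Real.cos (φ - ((2 * i + b : ℤ) : ℝ) * (Real.pi / M)) ≤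
        Real.cos (φ - ((2 * j + b : ℤ) : ℝ) * (Real.pi / M)) := by
  have hM0 : (M : ℝ) ≠ 0 := by positivity
  have hM' : (0 : ℤ) < M := by omega
  obtain ⟨j, -, hj⟩ := Finset.exists_max_image (Finset.range M)
    (fun i : ℕ => Real.cos (φ - ((2 * (i : ℤ) + b : ℤ) : ℝ) * (Real.pi / M)))
    ⟨0, Finset.mem_range.2 (by omega)⟩
  have key : ∀ i : ℤ, Real.cos (φ - ((2 * i + b : ℤ) : ℝ) * (Real.pi / M)) ≤
        Real.cos (φ - ((2 * (j : ℤ) + b : ℤ) : ℝ) * (Real.pi / M)) := by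
    intro i
    have h0 := Int.emod_nonneg i hM'.ne'
    have h1 := Int.emod_lt_of_pos i hM'
    have h := hj (i % M).toNat (Finset.mem_range.2 (by omega))
    rw [Int.toNat_of_nonneg h0] at h
    refine le_trans (le_of_eq ?_) h
    rw [← Real.cos_sub_int_mul_two_pi (φ - ((2 * (i % M) + b : ℤ) : ℝ) * (Real.pi / M)) (i / M)]
    congr 1
    have : (i : ℝ) = ((i % M : ℤ) : ℝ) + M * ((i / M : ℤ) : ℝ) := by
      exact_mod_cast (Int.emod_add_mul_ediv i M).symm
    push_cast [this]
    field_simp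
    ring
  refine ⟨j, ?_, key⟩
  obtain ⟨i, hi⟩ := exists_dir_near (by omega : 0 < M) φ b
  exact (cos_angle_le_of_abs_le hM hi).trans (key i)

/-! ### Separation for `|z| ≥ 1` as avoidance of discs -/

/-- The centres of the circles bounding Region I. -/
def outerCenters (M : ℕ) : Set ℂ :=
  {c | ∃ k : ℤ, (Even k ∧ c = (Real.cot (Real.pi / M) : ℝ) * dir M k) ∨
    (Odd k ∧ c = (1 / Real.sin (Real.pi / M) : ℝ) * dir M k)}

/-- The points outside the disc of radius `cosec (π/M)` and the open unit discs at the outer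
centres. -/
def outerClosed (M : ℕ) : Set ℂ :=
  {z | 1 / Real.sin (Real.pi / M) ≤ ‖z‖ ∧ ∀ c ∈ outerCenters M, 1 ≤ ‖z - c‖}

/-- The fade states at which any two distinct pairs of signal points are separated by the smaller
minimum distance of `S` and `zS`. -/
def separatedSet (M : ℕ) : Set ℂ :=
  {z | ∀ a ∈ pskDiffs M, ∀ b ∈ pskDiffs M, (a ≠ 0 ∨ b ≠ 0) →
    2 * Real.sin (Real.pi / M) * min 1 ‖z‖ ≤ ‖a + z * b‖}

/-- Beyond radius `cosec(π/M)`, and within angle `π/M` of a ray, the outermost admissible centre on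
that ray is the nearest one. Rotating an arbitrary centre to the ray of its parity nearest `z` only
brings it closer. -/
lemma one_le_norm_sub_of_mem_outerClosed {M : ℕ} (h4 : 4 ∣ M) (hM : 4 ≤ M) {z : ℂ}
    (hz : z ∈ outerClosed M) {m k : ℤ} (hmk : Odd (m + k))
    (hs : 0 ≤ Real.sin ((m : ℝ) * (Real.pi / M))) :
    1 ≤ ‖z - (Real.sin ((m : ℝ) * (Real.pi / M)) / Real.sin (Real.pi / M) : ℝ) * dir M k‖ := by
  obtain ⟨hr, hc⟩ := hz
  have hs1 := sin_angle_pos hM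
  have hc1 := cos_angle_pos hM
  rw [← abs_of_nonneg (norm_nonneg (z - _)), ← one_le_sq_iff_one_le_abs, norm_sub_mul_dir_sq]
  have hr' : 1 ≤ ‖z‖ * Real.sin (Real.pi / M) := by rwa [div_le_iff₀ hs1] at hr
  rcases Int.even_or_odd m with hm | hm
  · have hk : Odd k := by
      rw [Int.odd_add] at hmk
      rcases Int.even_or_odd k with h | h
      · exact absurd (hmk.2 h) (by simpa using hm)
      · exact h
    obtain ⟨i, rfl⟩ := hk
    obtain ⟨j, hj1, hj2⟩ := exists_dir_nearest hM z.arg 1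
    have h1 := hc _ ⟨2 * j + 1, Or.inr ⟨⟨j, rfl⟩, rfl⟩⟩
    rw [← abs_of_nonneg (norm_nonneg (z - _)), ← one_le_sq_iff_one_le_abs,
      norm_sub_mul_dir_sq] at h1
    have hji := hj2 i
    set w := Real.cos (z.arg - ((2 * j + 1 : ℤ) : ℝ) * (Real.pi / M))
    set v := Real.cos (z.arg - ((2 * i + 1 : ℤ) : ℝ) * (Real.pi / M))
    set a := Real.sin ((m : ℝ) * (Real.pi / M))
    set s := Real.sin (Real.pi / M)
    set c := Real.cos (Real.pi / M)
    set r := ‖z‖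
    refine h1.trans ?_
    have e1 : a / s * r * v ≤ a / s * r * w := by gcongr
    -- The product is the squared distance to the centre of modulus `a / s` minus that to the
    -- outermost centre, both on the nearest ray.
    suffices h : 0 ≤ (1 / s - a / s) * (2 * (r * w) - (1 / s + a / s)) by nlinarith
    have ha := abs_sin_le_cos_two_of_even h4 hM hm
    rw [abs_of_nonneg hs, Real.cos_two_mul] at ha
    have ha1 : a ≤ 1 := Real.sin_le_one _
    rcases ha with ha | ha
    · rw [show a = 1 from ha]; simp
    · have hc1' : c ≤ 1 := Real.cos_le_one _
      have h2 : 1 / s + a / s ≤ 2 * (r * w) := by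
        rw [← add_div, div_le_iff₀ hs1]
        have : c ≤ r * s * w := by nlinarith
        change a ≤ 2 * c ^ 2 - 1 at ha
        nlinarith
      have h3 : a / s ≤ 1 / s := by gcongr
      apply mul_nonneg <;> linarith
  · have hk : Even k := by
      rw [Int.odd_add] at hmk
      exact hmk.1 hm
    obtain ⟨i, rfl⟩ := hk
    obtain ⟨j, hj1, hj2⟩ := exists_dir_nearest hM z.arg 0
    have h1 := hc _ ⟨2 * j + 0, Or.inl ⟨⟨j, by ring⟩, rfl⟩⟩
    rw [← abs_of_nonneg (norm_nonneg (z - _)), ← one_le_sq_iff_one_le_abs,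
      norm_sub_mul_dir_sq] at h1
    have hji := hj2 i
    rw [show 2 * i + 0 = i + i by ring] at hji
    have ha := abs_sin_le_cos_of_odd h4 hM hm
    rw [abs_of_nonneg hs] at ha
    rw [Real.cot_eq_cos_div_sin] at h1
    set w := Real.cos (z.arg - ((2 * j + 0 : ℤ) : ℝ) * (Real.pi / M))
    set v := Real.cos (z.arg - ((i + i : ℤ) : ℝ) * (Real.pi / M))
    set a := Real.sin ((m : ℝ) * (Real.pi / M))
    set s := Real.sin (Real.pi / M)
    set c := Real.cos (Real.pi / M)
    set r := ‖z‖
    refine h1.trans ?_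
    have e1 : a / s * r * v ≤ a / s * r * w := by gcongr
    suffices h : 0 ≤ (c / s - a / s) * (2 * (r * w) - (c / s + a / s)) by nlinarith
    have h3 : a / s ≤ c / s := by gcongr
    have h2 : c / s ≤ r * w := by
      rw [div_le_iff₀ hs1]
      nlinarith
    apply mul_nonneg <;> linarith

/-- The radii `sin(nπ/M) / sin(π/M)` cut the annulus into rings. The open unit discs centred at
radius index `m`, along directions of the parity of `m + 1`, cover the ring from index `m` to `m +
1`. -/
lemma exists_norm_sub_lt_one {M : ℕ} (h4 : 4 ∣ M) (hM : 4 ≤ M) {z : ℂ} (h1 : 1 ≤ ‖z‖)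
    (h2 : ‖z‖ < 1 / Real.sin (Real.pi / M)) :
    ∃ m k : ℤ, Odd (m + k) ∧
      ‖z - (Real.sin ((m : ℝ) * (Real.pi / M)) / Real.sin (Real.pi / M) : ℝ) * dir M k‖ < 1 := by
  obtain ⟨q, hq⟩ := h4
  have hs1 := sin_angle_pos hM
  have hq0 : 0 < q := by omega
  have hq' : (q : ℝ) ≠ 0 := by positivity
  rw [lt_div_iff₀ hs1] at h2
  have hex : ∃ n : ℕ, ‖z‖ * Real.sin (Real.pi / M) < Real.sin (n * (Real.pi / M)) := by
    refine ⟨2 * q, ?_⟩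
    have : ((2 * q : ℕ) : ℝ) * (Real.pi / M) = Real.pi / 2 := by
      rw [hq]; push_cast; field_simp; norm_num
    rwa [this, Real.sin_pi_div_two]
  classical
  have hn2 : Nat.find hex ≤ 2 * q := by
    apply Nat.find_min'
    have : ((2 * q : ℕ) : ℝ) * (Real.pi / M) = Real.pi / 2 := by
      rw [hq]; push_cast; field_simp; norm_num
    rwa [this, Real.sin_pi_div_two]
  have hspec := Nat.find_spec hex
  have hmin := fun m => Nat.find_min hex (m := m)
  generalize Nat.find hex = n at hn2 hspec hmin
  -- The first index whose radius exceeds `|z|` is positive, and its predecessor gives the centre.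
  rcases n with _ | m
  · simp only [Nat.cast_zero, zero_mul, Real.sin_zero] at hspec
    nlinarith
  have hm := not_lt.1 (hmin m (Nat.lt_succ_self m))
  have hm0 : 0 ≤ Real.sin (m * (Real.pi / M)) := by
    apply Real.sin_nonneg_of_nonneg_of_le_pi (by positivity)
    have : (m : ℝ) ≤ 2 * q := by exact_mod_cast (by omega : m ≤ 2 * q)
    calc (m : ℝ) * (Real.pi / M) ≤ 2 * q * (Real.pi / M) := by gcongr
      _ = Real.pi / 2 := by rw [hq]; push_cast; field_simp; norm_num
      _ ≤ Real.pi := by linarith [Real.pi_pos]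
  obtain ⟨j, hj⟩ := exists_dir_near (by omega : 0 < M) z.arg (m + 1)
  refine ⟨m, 2 * j + (m + 1), ⟨m + j, by ring⟩, ?_⟩
  rw [← abs_of_nonneg (norm_nonneg (z - _)), ← sq_lt_one_iff_abs_lt_one, norm_sub_mul_dir_sq]
  have hcos := cos_angle_le_of_abs_le hM hj
  have hadd : Real.sin (((m + 1 : ℕ) : ℝ) * (Real.pi / M)) =
      Real.sin (m * (Real.pi / M)) * Real.cos (Real.pi / M) +
        Real.cos (m * (Real.pi / M)) * Real.sin (Real.pi / M) := by
    rw [← Real.sin_add]; congr 1; push_cast; ring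
  have i1 := Real.sin_sq_add_cos_sq (m * (Real.pi / M))
  have i2 := Real.sin_sq_add_cos_sq (Real.pi / M)
  have hc1 := Real.cos_le_one (Real.pi / M)
  set w := Real.cos (z.arg - ((2 * j + (m + 1) : ℤ) : ℝ) * (Real.pi / M))
  rw [Int.cast_natCast]
  set b := Real.sin (((m + 1 : ℕ) : ℝ) * (Real.pi / M))
  set d := Real.cos (m * (Real.pi / M))
  set a := Real.sin (m * (Real.pi / M))
  set s := Real.sin (Real.pi / M)
  set c := Real.cos (Real.pi / M)
  set r := ‖z‖
  -- Law of cosines in a triangle of circumdiameter 1: the sides `b` and `a` enclose the angle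
  -- `π/M`, so the third side is `s`.
  have hid : b ^ 2 + a ^ 2 - 2 * b * a * c = s ^ 2 := by
    rw [hadd]
    linear_combination s ^ 2 * i1 - a ^ 2 * i2
  have hlt : (r * s) ^ 2 + a ^ 2 - 2 * (r * s) * a * w < s ^ 2 := by
    have g1 : (r * s) * a * c ≤ (r * s) * a * w := by gcongr
    -- The factored gap between the values of `x ↦ x² - 2acx` at `b` and at `r * s`; it is positive
    -- because `a ≤ r * s < b`.
    have g2 : 0 < (b - r * s) * (b + r * s - 2 * a * c) := by
      apply mul_pos <;> nlinarith
    nlinarith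
  have e : r ^ 2 + (a / s) ^ 2 - 2 * (a / s) * r * w =
      ((r * s) ^ 2 + a ^ 2 - 2 * (r * s) * a * w) / s ^ 2 := by
    field_simp
  rw [e, div_lt_one (by positivity)]
  exact hlt

/-- This is what seals the inside off from the outside. The open discs at the even centres cover
this circle except for the points midway between even directions, and those are the odd centres
themselves. -/
lemma exists_outerCenter_norm_sub_lt_one {M : ℕ} (hM : 4 ≤ M) {z : ℂ}
    (hz : ‖z‖ = 1 / Real.sin (Real.pi / M)) : ∃ c ∈ outerCenters M, ‖z - c‖ < 1 := by
  have hs1 := sin_angle_pos hM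
  have hc1 := cos_angle_pos hM
  obtain ⟨j, hj⟩ := exists_dir_near (by omega : 0 < M) z.arg 0
  rcases hj.lt_or_eq with hj | hj
  · refine ⟨_, ⟨2 * j + 0, Or.inl ⟨⟨j, by ring⟩, rfl⟩⟩, ?_⟩
    rw [← abs_of_nonneg (norm_nonneg (z - _)), ← sq_lt_one_iff_abs_lt_one, norm_sub_mul_dir_sq,
      hz, Real.cot_eq_cos_div_sin]
    have hcos : Real.cos (Real.pi / M) <
        Real.cos (z.arg - ((2 * j + 0 : ℤ) : ℝ) * (Real.pi / M)) := by
      rw [← Real.cos_abs (z.arg - _)]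
      exact Real.cos_lt_cos_of_nonneg_of_le_pi (abs_nonneg _)
        (by linarith [angle_le hM, Real.pi_pos]) hj
    have i2 := Real.sin_sq_add_cos_sq (Real.pi / M)
    set w := Real.cos (z.arg - ((2 * j + 0 : ℤ) : ℝ) * (Real.pi / M))
    set s := Real.sin (Real.pi / M)
    set c := Real.cos (Real.pi / M)
    have e : (1 / s) ^ 2 + (c / s) ^ 2 - 2 * (c / s) * (1 / s) * w =
        (1 + c ^ 2 - 2 * c * w) / s ^ 2 := by
      field_simp
    rw [e, div_lt_one (by positivity)]
    nlinarith
  · obtain ⟨k, hk, hk2⟩ : ∃ k : ℤ, Odd k ∧ z.arg = k * (Real.pi / M) := by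
      rcases (abs_eq (angle_pos (by omega : 0 < M)).le).1 hj with h | h
      · exact ⟨2 * j + 1, ⟨j, rfl⟩, by push_cast at h ⊢; linarith⟩
      · exact ⟨2 * j - 1, ⟨j - 1, by ring⟩, by push_cast at h ⊢; linarith⟩
    refine ⟨_, ⟨k, Or.inr ⟨hk, rfl⟩⟩, ?_⟩
    rw [← abs_of_nonneg (norm_nonneg (z - _)), ← sq_lt_one_iff_abs_lt_one, norm_sub_mul_dir_sq,
      hz, hk2, sub_self, Real.cos_zero]
    ring_nf
    norm_num

/-- A negative sine is absorbed by `(m, k) ↦ (-m, k + M)`, which keeps the parity because `M` is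
even. -/
lemma exists_nonneg_rep {M : ℕ} (h4 : 4 ∣ M) (hM : 4 ≤ M) {d : ℂ} (hd : d ∈ pskDiffs M) :
    ∃ m k : ℤ, Odd (m + k) ∧ 0 ≤ Real.sin ((m : ℝ) * (Real.pi / M)) ∧
      d = ((2 * Real.sin ((m : ℝ) * (Real.pi / M)) : ℝ) : ℂ) * dir M k := by
  obtain ⟨m, k, ⟨r, hr⟩, rfl⟩ := (mem_pskDiffs_iff h4 (by omega)).1 hd
  rcases le_total 0 (Real.sin ((m : ℝ) * (Real.pi / M))) with h | h
  · exact ⟨m, k, ⟨r, hr⟩, h, rfl⟩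
  · obtain ⟨q, hq⟩ := h4
    refine ⟨-m, k + M, ⟨r - m + 2 * q, by rw [hq]; push_cast; linarith⟩, ?_, ?_⟩
    · push_cast
      rw [neg_mul, Real.sin_neg]
      linarith
    · rw [dir_add_card (by omega)]
      push_cast
      rw [neg_mul, Complex.sin_neg]
      ring

lemma norm_ofReal_mul_dir (M : ℕ) (k : ℤ) {t : ℝ} (ht : 0 ≤ t) : ‖(t : ℂ) * dir M k‖ = t := by
  rw [norm_mul, norm_dir, mul_one, Complex.norm_real, Real.norm_of_nonneg ht]

lemma le_norm_of_mem_pskDiffs {M : ℕ} (h4 : 4 ∣ M) (hM : 4 ≤ M) {d : ℂ} (hd : d ∈ pskDiffs M)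
    (h0 : d ≠ 0) : 2 * Real.sin (Real.pi / M) ≤ ‖d‖ := by
  obtain ⟨m, k, -, hs, rfl⟩ := exists_nonneg_rep h4 hM hd
  rw [norm_ofReal_mul_dir _ _ (by positivity)]
  have hnd : ¬ (M : ℤ) ∣ m := by
    rintro ⟨j, rfl⟩
    apply h0
    have hM' : (M : ℝ) ≠ 0 := by positivity
    have : (((M : ℤ) * j : ℤ) : ℝ) * (Real.pi / M) = j * Real.pi := by
      push_cast
      field_simp
    rw [this, Real.sin_int_mul_pi]
    simp
  have := sin_le_abs_sin_of_not_dvd (by omega : 0 < M) hnd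
  rw [abs_of_nonneg hs] at this
  linarith

lemma norm_le_two_of_mem_pskDiffs {M : ℕ} (h4 : 4 ∣ M) (hM : 4 ≤ M) {d : ℂ}
    (hd : d ∈ pskDiffs M) : ‖d‖ ≤ 2 := by
  obtain ⟨m, k, -, hs, rfl⟩ := exists_nonneg_rep h4 hM hd
  rw [norm_ofReal_mul_dir _ _ (by positivity)]
  linarith [Real.sin_le_one ((m : ℝ) * (Real.pi / M))]

/-- Factoring out `b` exhibits the distance as a multiple of the distance from `z` to the singular
fade state `-a/b`; the half turn `M` supplies the minus sign. -/
lemma add_mul_eq_dir_mul_sub {M : ℕ} (hM : 0 < M) (x y : ℝ) (hy : y ≠ 0) (z : ℂ) (k l : ℤ) :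
    (x : ℂ) * dir M k + z * ((y : ℂ) * dir M l) =
      (y * dir M l) * (z - (x / y : ℝ) * dir M (k - l + M)) := by
  have hy' : (y : ℂ) ≠ 0 := by exact_mod_cast hy
  have h := dir_ne_zero M l
  rw [dir_add_card hM, sub_eq_add_neg k l, dir_add, dir_neg]
  push_cast
  field_simp
  ring

/-- When `b` is not shortest, the triangle inequality suffices: `|z b| ≥ 4 cos(π/M)` and `|a| ≤ 2`.
-/
lemma two_sin_le_norm_of_eight_le {M : ℕ} (h4 : 4 ∣ M) (hM : 8 ≤ M) {z a b : ℂ}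
    (hz : 1 / Real.sin (Real.pi / M) ≤ ‖z‖) (ha : a ∈ pskDiffs M)
    (hb : 2 * Real.sin (2 * (Real.pi / M)) ≤ ‖b‖) :
    2 * Real.sin (Real.pi / M) ≤ ‖a + z * b‖ := by
  have hs1 := sin_angle_pos (by omega : 4 ≤ M)
  have ha' := norm_le_two_of_mem_pskDiffs h4 (by omega) ha
  have ht0 := angle_pos (by omega : 0 < M)
  have ht : Real.pi / M ≤ Real.pi / 8 := by
    have : (8 : ℝ) ≤ M := by exact_mod_cast hM
    gcongr
  -- With `t = π/M`, these bounds reduce `4 cos t - 2 ≥ 2 sin t` to `t² + t ≤ 1`, true for `t ≤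
  -- π/8`.
  have hcos := Real.one_sub_sq_div_two_le_cos (x := Real.pi / M)
  have hsin := Real.sin_le ht0.le
  have hpi := Real.pi_lt_d2
  rw [Real.sin_two_mul] at hb
  rw [div_le_iff₀ hs1] at hz
  have h1 : 4 * Real.cos (Real.pi / M) ≤ ‖z * b‖ := by
    rw [norm_mul]
    have hc := cos_angle_pos (by omega : 4 ≤ M)
    calc 4 * Real.cos (Real.pi / M) ≤ 4 * Real.cos (Real.pi / M) * (‖z‖ * Real.sin (Real.pi / M)) :=
          le_mul_of_one_le_right (by positivity) hz
      _ = ‖z‖ * (2 * (2 * Real.sin (Real.pi / M) * Real.cos (Real.pi / M))) := by ring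
      _ ≤ ‖z‖ * ‖b‖ := by gcongr
  have h2 : ‖z * b‖ - ‖a‖ ≤ ‖a + z * b‖ := by
    have := norm_sub_norm_le (z * b) (-a)
    rw [norm_neg, sub_neg_eq_add, add_comm] at this
    exact this
  nlinarith

/-- For `M = 4` the crude estimate fails when both differences are diameters. In that case `-a/b` is
itself an even outer centre, since `cot(π/4) = 1`; otherwise `|a| ≤ √2` and the triangle inequality
works. -/
lemma two_sin_le_norm_of_four {z a b : ℂ} (hz : z ∈ outerClosed 4) (ha : a ∈ pskDiffs 4)
    (hbm : b ∈ pskDiffs 4) (hb : 2 * Real.sin (2 * (Real.pi / (4 : ℕ))) ≤ ‖b‖) :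
    2 * Real.sin (Real.pi / (4 : ℕ)) ≤ ‖a + z * b‖ := by
  have e2 : Real.sin (2 * (Real.pi / (4 : ℕ))) = 1 := by
    rw [← Real.sin_pi_div_two]; congr 1; push_cast; ring
  have e3 : Real.cos (2 * (Real.pi / (4 : ℕ))) = 0 := by
    rw [← Real.cos_pi_div_two]; congr 1; push_cast; ring
  have e1 : Real.sin (Real.pi / (4 : ℕ)) = √2 / 2 := by push_cast; exact Real.sin_pi_div_four
  have e4 : Real.cos (Real.pi / (4 : ℕ)) = √2 / 2 := by push_cast; exact Real.cos_pi_div_four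
  have hr := hz.1
  have hsq := Real.mul_self_sqrt (show (0 : ℝ) ≤ 2 by norm_num)
  have hpos : 0 < √2 := by positivity
  have hlt : √2 < 2 := by nlinarith
  have hz2 : √2 ≤ ‖z‖ := by
    rw [e1, div_le_iff₀ (by positivity)] at hr
    nlinarith
  obtain ⟨m, k, hmk, hsm, rfl⟩ := exists_nonneg_rep (M := 4) (by norm_num) (by norm_num) ha
  obtain ⟨n, l, hnl, hsn, rfl⟩ := exists_nonneg_rep (M := 4) (by norm_num) (by norm_num) hbm
  have hnorm := norm_ofReal_mul_dir 4 l
    (show 0 ≤ 2 * Real.sin ((n : ℝ) * (Real.pi / (4 : ℕ))) by positivity)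
  have hnorm' := norm_ofReal_mul_dir 4 k
    (show 0 ≤ 2 * Real.sin ((m : ℝ) * (Real.pi / (4 : ℕ))) by positivity)
  rw [hnorm, e2] at hb
  have hn1 : Real.sin ((n : ℝ) * (Real.pi / (4 : ℕ))) = 1 :=
    le_antisymm (Real.sin_le_one _) (by linarith)
  have hn : Even n := by
    by_contra hn
    have := abs_sin_le_cos_of_odd (M := 4) (by norm_num) (by norm_num) (Int.not_even_iff_odd.1 hn)
    rw [hn1, abs_one, e4] at this
    linarith
  by_cases hm1 : Real.sin ((m : ℝ) * (Real.pi / (4 : ℕ))) = 1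
  · have hm : Even m := by
      by_contra hm
      have := abs_sin_le_cos_of_odd (M := 4) (by norm_num) (by norm_num)
        (Int.not_even_iff_odd.1 hm)
      rw [hm1, abs_one, e4] at this
      linarith
    rw [hm1, hn1, add_mul_eq_dir_mul_sub (by norm_num) _ _ (by norm_num), norm_mul,
      norm_ofReal_mul_dir _ _ (by norm_num)]
    have hcen := hz.2 (((2 * 1 / (2 * 1) : ℝ) : ℂ) * dir 4 (k - l + (4 : ℕ)))
      ⟨k - l + (4 : ℕ), Or.inl ⟨?_, ?_⟩⟩
    · rw [e1]
      linarith
    · push_cast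
      rw [Int.odd_add] at hmk hnl
      grind
    · rw [Real.cot_eq_cos_div_sin, e1, e4, div_self (by positivity)]
      norm_num
  · have hm : Real.sin ((m : ℝ) * (Real.pi / (4 : ℕ))) ≤ √2 / 2 := by
      rcases Int.even_or_odd m with h | h
      · have := abs_sin_le_cos_two_of_even (M := 4) (by norm_num) (by norm_num) h
        rw [abs_of_nonneg hsm, e3] at this
        rcases this with h | h
        · exact absurd h hm1
        · linarith
      · have := abs_sin_le_cos_of_odd (M := 4) (by norm_num) (by norm_num) h
        rwa [abs_of_nonneg hsm, e4] at this
    have h2 := norm_sub_norm_le (z * (((2 * Real.sin ((n : ℝ) * (Real.pi / (4 : ℕ))) : ℝ) : ℂ) *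
      dir 4 l)) (-(((2 * Real.sin ((m : ℝ) * (Real.pi / (4 : ℕ))) : ℝ) : ℂ) * dir 4 k))
    rw [norm_neg, sub_neg_eq_add, add_comm (z * _), norm_mul z, hnorm, hnorm', hn1] at h2
    rw [hn1, e1]
    linarith

lemma mem_separatedSet_of_mem_outerClosed {M : ℕ} (h4 : 4 ∣ M) (hM : 4 ≤ M) {z : ℂ}
    (hz : z ∈ outerClosed M) : z ∈ separatedSet M := by
  have hs1 := sin_angle_pos hM
  have hz1 : 1 ≤ ‖z‖ :=
    le_trans (by rw [le_div_iff₀ hs1, one_mul]; exact Real.sin_le_one _) hz.1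
  intro a ha b hb hab
  rw [min_eq_left hz1, mul_one]
  obtain ⟨n, l, hnl, hsn, hbe⟩ := exists_nonneg_rep h4 hM hb
  have hnorm := norm_ofReal_mul_dir M l
    (show 0 ≤ 2 * Real.sin ((n : ℝ) * (Real.pi / M)) by positivity)
  rw [← hbe] at hnorm
  rcases abs_sin_angle_cases hM n with h | ⟨j, h⟩ | h
  · rw [h] at hbe
    have : b = 0 := by simpa using hbe
    rw [this, mul_zero, add_zero]
    refine le_norm_of_mem_pskDiffs h4 hM ha ?_
    rcases hab with h | h
    · exact h
    · exact absurd this h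
  · have hM0 : (M : ℝ) ≠ 0 := by positivity
    have hsin : Real.sin ((n : ℝ) * (Real.pi / M)) = Real.sin (Real.pi / M) := by
      rw [← abs_of_nonneg hsn, ← abs_of_nonneg hs1.le]
      rcases h with rfl | rfl
      · have : ((1 + M * j : ℤ) : ℝ) * (Real.pi / M) = Real.pi / M + j * Real.pi := by
          push_cast
          field_simp
        rw [this, Real.sin_add_int_mul_pi, abs_mul, abs_zpow]
        simp
      · have : ((-1 + M * j : ℤ) : ℝ) * (Real.pi / M) = -(Real.pi / M) + j * Real.pi := by
          push_cast
          field_simp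
        rw [this, Real.sin_add_int_mul_pi, abs_mul, abs_zpow, Real.sin_neg]
        simp
    obtain ⟨q, hq⟩ := h4
    have hl : Even l := by
      rw [hq] at h
      push_cast at h
      rw [mul_assoc] at h
      generalize (q : ℤ) * j = x at h
      rw [Int.even_iff]
      rw [Int.odd_iff] at hnl
      omega
    obtain ⟨m, k, hmk, hsm, rfl⟩ := exists_nonneg_rep ⟨q, hq⟩ hM ha
    rw [hsin] at hbe
    rw [hbe, add_mul_eq_dir_mul_sub (by omega) _ _ (by positivity), norm_mul,
      norm_ofReal_mul_dir _ _ (by positivity), mul_div_mul_left _ _ two_ne_zero]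
    apply le_mul_of_one_le_right (by positivity)
    refine one_le_norm_sub_of_mem_outerClosed ⟨q, hq⟩ hM hz ?_ hsm
    rw [Int.odd_iff] at hmk ⊢
    rw [Int.even_iff] at hl
    omega
  · rw [abs_of_nonneg hsn] at h
    have hb' : 2 * Real.sin (2 * (Real.pi / M)) ≤ ‖b‖ := by rw [hnorm]; linarith
    rcases (by omega : M = 4 ∨ 8 ≤ M) with rfl | h8
    · exact two_sin_le_norm_of_four hz ha hb hb'
    · exact two_sin_le_norm_of_eight_le h4 h8 hz.1 ha hb'

lemma mem_pskDiffs_of_even {M : ℕ} (h4 : 4 ∣ M) (hM : 4 ≤ M) {k : ℤ} (hk : Even k) :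
    ((2 * Real.sin (Real.pi / M) : ℝ) : ℂ) * dir M k ∈ pskDiffs M :=
  (mem_pskDiffs_iff h4 (by omega)).2 ⟨1, k, by rw [add_comm]; exact hk.add_one, by simp⟩

/-- Test separation against the shortest nonzero `b`. -/
lemma one_le_norm_sub_of_mem_separatedSet {M : ℕ} (h4 : 4 ∣ M) (hM : 4 ≤ M) {z : ℂ}
    (hz : z ∈ separatedSet M) (h1 : 1 ≤ ‖z‖) {m k : ℤ} (hmk : Odd (m + k)) :
    1 ≤ ‖z - (Real.sin ((m : ℝ) * (Real.pi / M)) / Real.sin (Real.pi / M) : ℝ) * dir M k‖ := by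
  have hs1 := sin_angle_pos hM
  have hM0 : 0 < M := by omega
  have ha := (mem_pskDiffs_iff (d := ((2 * Real.sin ((m : ℝ) * (Real.pi / M)) : ℝ) : ℂ) *
    dir M (k - M)) h4 (by omega)).2 ⟨m, k - M, by
      obtain ⟨q, hq⟩ := h4
      rw [Int.odd_iff] at hmk ⊢
      omega, rfl⟩
  have hb := mem_pskDiffs_of_even h4 hM (k := 0) (by simp)
  have hb0 : ((2 * Real.sin (Real.pi / M) : ℝ) : ℂ) * dir M 0 ≠ 0 :=
    mul_ne_zero (by exact_mod_cast (by positivity : 2 * Real.sin (Real.pi / M) ≠ 0))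
      (dir_ne_zero _ _)
  have h := hz _ ha _ hb (Or.inr hb0)
  rw [min_eq_left h1, mul_one, add_mul_eq_dir_mul_sub hM0 _ _ (by positivity), norm_mul,
    norm_ofReal_mul_dir _ _ (by positivity), mul_div_mul_left _ _ two_ne_zero] at h
  have e : k - M - 0 + M = k := by ring
  rw [e] at h
  exact (le_mul_iff_one_le_right (by positivity)).1 h

lemma mem_outerClosed_iff {M : ℕ} (h4 : 4 ∣ M) (hM : 4 ≤ M) {z : ℂ} :
    z ∈ outerClosed M ↔ 1 ≤ ‖z‖ ∧ z ∈ separatedSet M := by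
  have hs1 := sin_angle_pos hM
  constructor
  · intro hz
    exact ⟨le_trans (by rw [le_div_iff₀ hs1, one_mul]; exact Real.sin_le_one _) hz.1,
      mem_separatedSet_of_mem_outerClosed h4 hM hz⟩
  · rintro ⟨h1, hz⟩
    refine ⟨?_, ?_⟩
    · by_contra hlt
      obtain ⟨m, k, hmk, h⟩ := exists_norm_sub_lt_one h4 hM h1 (not_le.1 hlt)
      exact absurd (one_le_norm_sub_of_mem_separatedSet h4 hM hz h1 hmk) (not_le.2 h)
    · obtain ⟨q, hq⟩ := h4
      have hq' : (q : ℝ) ≠ 0 := by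
        have : 0 < q := by omega
        positivity
      rintro c ⟨k, ⟨hk, rfl⟩ | ⟨hk, rfl⟩⟩
      -- Since `2qπ/M = π/2`, the indices `2q - 1` and `2q` produce the moduli `cot(π/M)` and
      -- `cosec(π/M)`.
      · have h := one_le_norm_sub_of_mem_separatedSet ⟨q, hq⟩ hM hz h1 (m := 2 * q - 1) (k := k)
          (by rw [Int.odd_iff]; rw [Int.even_iff] at hk; omega)
        have e : ((2 * q - 1 : ℤ) : ℝ) * (Real.pi / M) = Real.pi / 2 - Real.pi / M := by
          rw [hq]; push_cast; field_simp; ring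
        rwa [e, Real.sin_pi_div_two_sub, ← Real.cot_eq_cos_div_sin] at h
      · have h := one_le_norm_sub_of_mem_separatedSet ⟨q, hq⟩ hM hz h1 (m := 2 * q) (k := k)
          (by rw [Int.odd_iff] at hk ⊢; omega)
        have e : ((2 * q : ℤ) : ℝ) * (Real.pi / M) = Real.pi / 2 := by
          rw [hq]; push_cast; field_simp; ring
        rwa [e, Real.sin_pi_div_two] at h

/-! ### Inversion symmetry of the separated set -/

/-- Interchanging `a` and `b` replaces `z` by `z⁻¹`, and both sides of the inequality scale by
`|z|⁻¹`. -/
lemma inv_mem_separatedSet {M : ℕ} {z : ℂ} (hz0 : z ≠ 0) (hz : z ∈ separatedSet M) :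
    z⁻¹ ∈ separatedSet M := by
  intro a ha b hb hab
  have h := hz b hb a ha hab.symm
  have hn : 0 < ‖z‖ := norm_pos_iff.2 hz0
  have e : a + z⁻¹ * b = z⁻¹ * (b + z * a) := by field_simp; ring
  have e2 : min 1 ‖z⁻¹‖ = ‖z‖⁻¹ * min 1 ‖z‖ := by
    rw [norm_inv, mul_min_of_nonneg _ _ (by positivity), mul_one, inv_mul_cancel₀ hn.ne', min_comm]
  rw [e, norm_mul, e2, norm_inv]
  calc _ = ‖z‖⁻¹ * (2 * Real.sin (Real.pi / M) * min 1 ‖z‖) := by ring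
    _ ≤ _ := by gcongr

lemma separatedSet_eq {M : ℕ} (h4 : 4 ∣ M) (hM : 4 ≤ M) :
    separatedSet M = outerClosed M ∪ insert 0 ((fun z : ℂ => z⁻¹) '' outerClosed M) := by
  ext z
  constructor
  · intro hz
    rcases le_total 1 ‖z‖ with h1 | h1
    · exact Or.inl ((mem_outerClosed_iff h4 hM).2 ⟨h1, hz⟩)
    · by_cases h0 : z = 0
      · exact Or.inr (Or.inl h0)
      · refine Or.inr (Or.inr ⟨z⁻¹, (mem_outerClosed_iff h4 hM).2
          ⟨?_, inv_mem_separatedSet h0 hz⟩, inv_inv z⟩)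
        rw [norm_inv]
        exact (one_le_inv₀ (norm_pos_iff.2 h0)).2 h1
  · rintro (hz | rfl | ⟨w, hw, rfl⟩)
    · exact mem_separatedSet_of_mem_outerClosed h4 hM hz
    · intro a _ b _ _
      simp
    · have hw' := (mem_outerClosed_iff h4 hM).1 hw
      refine inv_mem_separatedSet ?_ hw'.2
      rintro rfl
      simp at hw'
      linarith [hw'.1]

/-! ### Region I as an outer envelope -/

lemma finite_outerCenters {M : ℕ} (hM : 0 < M) : (outerCenters M).Finite := by
  refine (((Set.finite_lt_nat M).image fun j => (Real.cot (Real.pi / M) : ℝ) * evenDir M j).union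
    ((Set.finite_lt_nat M).image
      fun j => ((1 / Real.sin (Real.pi / M) : ℝ) : ℂ) * oddDir M j)).subset ?_
  rintro c ⟨k, ⟨hk, rfl⟩ | ⟨hk, rfl⟩⟩
  · obtain ⟨j, hj, h⟩ := exists_evenDir_eq hM hk
    exact Or.inl ⟨j, hj, by rw [h]⟩
  · obtain ⟨j, hj, h⟩ := exists_oddDir_eq hM hk
    exact Or.inr ⟨j, hj, by rw [h]⟩

lemma one_le_cot_angle {M : ℕ} (hM : 4 ≤ M) : 1 ≤ Real.cot (Real.pi / M) := by
  rw [Real.cot_eq_cos_div_sin, one_le_div (sin_angle_pos hM)]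
  have h := cos_two_angle_nonneg hM
  rw [Real.cos_two_mul] at h
  have := Real.sin_sq_add_cos_sq (Real.pi / M)
  exact abs_le_of_sq_le_sq' (by linarith) (cos_angle_pos hM).le |>.2

lemma norm_le_of_mem_outerCenters {M : ℕ} (hM : 4 ≤ M) {c : ℂ} (hc : c ∈ outerCenters M) :
    ‖c‖ ≤ 1 / Real.sin (Real.pi / M) := by
  have hs1 := sin_angle_pos hM
  obtain ⟨k, ⟨-, rfl⟩ | ⟨-, rfl⟩⟩ := hc
  · rw [norm_ofReal_mul_dir _ _ (by linarith [one_le_cot_angle hM]), Real.cot_eq_cos_div_sin]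
    gcongr
    exact Real.cos_le_one _
  · rw [norm_ofReal_mul_dir _ _ (by positivity)]

lemma sUnion_outerCircles {M : ℕ} (hM : 0 < M) :
    ⋃₀ outerCircles M = {z | ∃ c ∈ outerCenters M, ‖z - c‖ = 1} := by
  ext z
  constructor
  · rintro ⟨C, ⟨k, hk, rfl | rfl⟩, hz⟩
    · exact ⟨_, ⟨2 * k, Or.inl ⟨by simp, rfl⟩⟩, by
        rw [← evenDir_eq_dir]; exact mem_sphere_iff_norm.1 hz⟩
    · exact ⟨_, ⟨2 * k + 1, Or.inr ⟨⟨k, rfl⟩, rfl⟩⟩, by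
        rw [← oddDir_eq_dir]; exact mem_sphere_iff_norm.1 hz⟩
  · rintro ⟨c, ⟨k, ⟨hk, rfl⟩ | ⟨hk, rfl⟩⟩, hz⟩
    · obtain ⟨j, hj, h⟩ := exists_evenDir_eq hM hk
      rw [h] at hz
      exact ⟨_, ⟨j, hj, Or.inl rfl⟩, mem_sphere_iff_norm.2 hz⟩
    · obtain ⟨j, hj, h⟩ := exists_oddDir_eq hM hk
      rw [h] at hz
      exact ⟨_, ⟨j, hj, Or.inr rfl⟩, mem_sphere_iff_norm.2 hz⟩

/-- The points outside the closed disc of radius `cosec (π/M)` and the closed unit discs at the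
outer centres. -/
def outerOpen (M : ℕ) : Set ℂ :=
  {z | 1 / Real.sin (Real.pi / M) < ‖z‖ ∧ ∀ c ∈ outerCenters M, 1 < ‖z - c‖}

lemma isOpen_outerOpen {M : ℕ} (hM : 0 < M) : IsOpen (outerOpen M) := by
  have : outerOpen M = {z | 1 / Real.sin (Real.pi / M) < ‖z‖} ∩
      ⋂ c ∈ outerCenters M, {z | 1 < ‖z - c‖} := by
    ext z; simp [outerOpen]
  rw [this]
  exact (isOpen_lt (by fun_prop) (by fun_prop)).inter
    ((finite_outerCenters hM).isOpen_biInter fun c _ => isOpen_lt (by fun_prop) (by fun_prop))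

lemma isClosed_outerClosed (M : ℕ) : IsClosed (outerClosed M) := by
  have : outerClosed M = {z | 1 / Real.sin (Real.pi / M) ≤ ‖z‖} ∩
      ⋂ c ∈ outerCenters M, {z | 1 ≤ ‖z - c‖} := by
    ext z; simp [outerClosed]
  rw [this]
  exact (isClosed_le (by fun_prop) (by fun_prop)).inter
    (isClosed_biInter fun c _ => isClosed_le (by fun_prop) (by fun_prop))

lemma outerOpen_subset_outerClosed (M : ℕ) : outerOpen M ⊆ outerClosed M :=
  fun _ h => ⟨h.1.le, fun c hc => (h.2 c hc).le⟩

/-- Moving outward along the ray of `z` strictly increases the distance to `c`, because `⟨z, c⟩ ≤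
|z|²`. -/
lemma one_lt_norm_mul_sub {z c : ℂ} (hz : z ≠ 0) (hcz : ‖c‖ ≤ ‖z‖) (h : 1 ≤ ‖z - c‖) {t : ℝ}
    (ht : 1 < t) : 1 < ‖t * z - c‖ := by
  have hz' := norm_pos_iff.2 hz
  have hinner : inner ℝ z c ≤ ‖z‖ * ‖z‖ :=
    (real_inner_le_norm z c).trans (by gcongr)
  have h1 : ‖(t : ℂ) * z - c‖ ^ 2 = ‖z - c‖ ^ 2 + 2 * (t - 1) * (‖z‖ * ‖z‖ - inner ℝ z c) +
      (t - 1) ^ 2 * ‖z‖ ^ 2 := by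
    have e : (t : ℂ) * z = t • z := (Complex.real_smul).symm
    rw [e, norm_sub_sq_real, norm_sub_sq_real, inner_smul_left, norm_smul, mul_pow,
      Real.norm_eq_abs, sq_abs]
    simp only [conj_trivial]
    ring
  rw [← abs_of_nonneg (norm_nonneg (_ - c)), ← one_lt_sq_iff_one_lt_abs, h1]
  have h2 : 0 < (t - 1) ^ 2 * ‖z‖ ^ 2 := by
    have : 0 < t - 1 := by linarith
    positivity
  have h3 : 0 ≤ 2 * (t - 1) * (‖z‖ * ‖z‖ - inner ℝ z c) :=
    mul_nonneg (by linarith) (by linarith)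
  nlinarith

lemma mul_mem_outerOpen {M : ℕ} (hM : 4 ≤ M) {z : ℂ} (hz : z ∈ outerClosed M) {t : ℝ}
    (ht : 1 < t) : (t : ℂ) * z ∈ outerOpen M := by
  have hs1 := sin_angle_pos hM
  have hpos : 0 < ‖z‖ := lt_of_lt_of_le (by positivity) hz.1
  constructor
  · rw [norm_mul, Complex.norm_real, Real.norm_of_nonneg (by linarith)]
    nlinarith [hz.1]
  · intro c hc
    exact one_lt_norm_mul_sub (norm_pos_iff.1 hpos)
      ((norm_le_of_mem_outerCenters hM hc).trans hz.1) (hz.2 c hc) ht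

lemma closure_outerOpen {M : ℕ} (hM : 4 ≤ M) : closure (outerOpen M) = outerClosed M := by
  refine (closure_minimal (outerOpen_subset_outerClosed M) (isClosed_outerClosed M)).antisymm ?_
  intro z hz
  have hlim : Filter.Tendsto (fun t : ℝ => (t : ℂ) * z) (nhdsWithin 1 (Set.Ioi 1)) (nhds z) := by
    have : Continuous fun t : ℝ => (t : ℂ) * z := by fun_prop
    simpa using (this.tendsto 1).mono_left nhdsWithin_le_nhds
  refine mem_closure_of_tendsto hlim ?_
  filter_upwards [self_mem_nhdsWithin] with t ht
  exact mul_mem_outerOpen hM hz ht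

lemma outerOpen_subset_compl {M : ℕ} (hM : 0 < M) : outerOpen M ⊆ (⋃₀ outerCircles M)ᶜ := by
  rw [sUnion_outerCircles hM]
  rintro z hz ⟨c, hc, h⟩
  exact (hz.2 c hc).ne' h

/-- Thus `outerOpen` is relatively closed in the complement of the circles: the bounding circle of
radius `cosec(π/M)` is hidden inside the open discs. -/
lemma outerClosed_inter_compl_subset {M : ℕ} (hM : 4 ≤ M) :
    outerClosed M ∩ (⋃₀ outerCircles M)ᶜ ⊆ outerOpen M := by
  rw [sUnion_outerCircles (by omega)]
  rintro z ⟨hz, hn⟩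
  refine ⟨lt_of_le_of_ne hz.1 ?_, fun c hc => lt_of_le_of_ne (hz.2 c hc) ?_⟩
  · intro h
    obtain ⟨c, hc, h'⟩ := exists_outerCenter_norm_sub_lt_one hM h.symm
    exact absurd (hz.2 c hc) (not_le.2 h')
  · intro h
    exact hn ⟨c, hc, h.symm⟩

lemma not_isBounded_of_mem_outerOpen {M : ℕ} (hM : 4 ≤ M) {z : ℂ} (hz : z ∈ outerOpen M) :
    ¬ Bornology.IsBounded (connectedComponentIn (⋃₀ outerCircles M)ᶜ z) := by
  have hs1 := sin_angle_pos hM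
  have hpos : 0 < ‖z‖ := lt_trans (by positivity) hz.1
  have hray : (fun t : ℝ => (t : ℂ) * z) '' Set.Ici 1 ⊆
      connectedComponentIn (⋃₀ outerCircles M)ᶜ z := by
    apply IsPreconnected.subset_connectedComponentIn
    · exact isPreconnected_Ici.image _ (by fun_prop)
    · exact ⟨1, Set.self_mem_Ici, by simp⟩
    · rintro _ ⟨t, ht, rfl⟩
      apply outerOpen_subset_compl (by omega)
      rcases (Set.mem_Ici.1 ht).eq_or_lt with rfl | h
      · simpa using hz
      · exact mul_mem_outerOpen hM (outerOpen_subset_outerClosed M hz) h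
  intro hb
  obtain ⟨R, hR⟩ := (hb.subset hray).exists_norm_le
  have h := hR _ ⟨max 1 ((R + 1) / ‖z‖), Set.mem_Ici.2 (le_max_left _ _), rfl⟩
  rw [norm_mul, Complex.norm_real, Real.norm_of_nonneg (by positivity)] at h
  have : (R + 1) / ‖z‖ * ‖z‖ ≤ max 1 ((R + 1) / ‖z‖) * ‖z‖ := by
    gcongr
    exact le_max_right _ _
  rw [div_mul_cancel₀ _ hpos.ne'] at this
  linarith

/-- Radial rays make every component meeting `outerOpen` unbounded. A component that gets far from
the origin meets `outerOpen`, which is relatively clopen, and so lies inside it. -/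
lemma regionI_eq {M : ℕ} (hM : 4 ≤ M) : regionI M = outerClosed M := by
  rw [← closure_outerOpen hM]
  unfold regionI outerEnvelopeRegion
  congr 1
  ext z
  refine ⟨?_, fun hz =>
    ⟨outerOpen_subset_compl (by omega) hz, not_isBounded_of_mem_outerOpen hM hz⟩⟩
  rintro ⟨hz, hub⟩
  by_contra hzV
  apply hub
  rw [isBounded_iff_forall_norm_le]
  refine ⟨1 / Real.sin (Real.pi / M) + 1, fun x hx => ?_⟩
  by_contra hlt
  apply hzV
  have hxV : x ∈ outerOpen M := by
    refine ⟨by linarith, fun c hc => ?_⟩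
    have := norm_le_of_mem_outerCenters hM hc
    have := norm_sub_norm_le x c
    linarith
  have hsub := isPreconnected_connectedComponentIn.subset_of_closure_inter_subset
    (isOpen_outerOpen (by omega : 0 < M)) ⟨x, hx, hxV⟩ (by
      rw [closure_outerOpen hM]
      exact (Set.inter_subset_inter_right _ (connectedComponentIn_subset _ _)).trans
        (outerClosed_inter_compl_subset hM))
  exact hsub (mem_connectedComponentIn hz)

/-! ### The inner curves as inverses of the outer circles -/

/-- A circle of Apollonius: for `w ≠ 0` the left side says that `w⁻¹` lies on the unit circle about
`t * u`. Clearing the denominator includes `w = 0` harmlessly, since both sides fail there. -/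
lemma norm_one_sub_mul_eq_iff {u : ℂ} (hu : ‖u‖ = 1) {t : ℝ} (ht : 1 < t) (w : ℂ) :
    ‖1 - t * u * w‖ = ‖w‖ ↔ ‖w - (t / (t ^ 2 - 1) : ℝ) * u⁻¹‖ = 1 / (t ^ 2 - 1) := by
  have hD : 0 < t ^ 2 - 1 := by nlinarith
  have hu0 : u ≠ 0 := norm_pos_iff.1 (by rw [hu]; exact one_pos)
  obtain ⟨v, rfl⟩ : ∃ v, w = u⁻¹ * v := ⟨u * w, by field_simp⟩
  have e1 : 1 - t * u * (u⁻¹ * v) = 1 - t * v := by field_simp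
  have e2 : u⁻¹ * v - (t / (t ^ 2 - 1) : ℝ) * u⁻¹ = u⁻¹ * (v - (t / (t ^ 2 - 1) : ℝ)) := by ring
  rw [e1, e2, norm_mul, norm_mul, norm_inv, hu, inv_one, one_mul, one_mul,
    ← sq_eq_sq₀ (norm_nonneg _) (norm_nonneg _), ← sq_eq_sq₀ (norm_nonneg _) (by positivity)]
  simp only [Complex.sq_norm, Complex.normSq_apply, Complex.sub_re, Complex.sub_im, Complex.one_re,
    Complex.one_im, Complex.mul_re, Complex.mul_im, Complex.ofReal_re, Complex.ofReal_im]
  have h3 : ((1 - (t * v.re - 0 * v.im)) * (1 - (t * v.re - 0 * v.im)) +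
      (0 - (t * v.im + 0 * v.re)) * (0 - (t * v.im + 0 * v.re)) - (v.re * v.re + v.im * v.im)) =
      (t ^ 2 - 1) * (((v.re - t / (t ^ 2 - 1)) * (v.re - t / (t ^ 2 - 1)) +
        (v.im - 0) * (v.im - 0)) - (1 / (t ^ 2 - 1)) ^ 2) := by
    field_simp
    ring
  rw [← sub_eq_zero, h3, mul_eq_zero, or_iff_right hD.ne', sub_eq_zero]

/-- The degenerate case `t = 1`: a circle through the origin inverts to a line. This is why `M = 4`
has straight boundary curves. -/
lemma norm_one_sub_eq_iff_re (v : ℂ) : ‖1 - v‖ = ‖v‖ ↔ v.re = 1 / 2 := by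
  rw [← sq_eq_sq₀ (norm_nonneg _) (norm_nonneg _)]
  simp only [Complex.sq_norm, Complex.normSq_apply, Complex.sub_re, Complex.sub_im, Complex.one_re,
    Complex.one_im]
  constructor <;> intro h <;> nlinarith

lemma norm_one_sub_odd_iff {M : ℕ} (hM : 4 ≤ M) (k : ℤ) (w : ℂ) :
    ‖1 - (1 / Real.sin (Real.pi / M) : ℝ) * dir M k * w‖ = ‖w‖ ↔
      ‖w - ((1 / Real.cos (Real.pi / M) * Real.tan (Real.pi / M) : ℝ) : ℂ) * dir M (-k)‖ =
        Real.tan (Real.pi / M) ^ 2 := by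
  have hs1 := sin_angle_pos hM
  have hc1 := cos_angle_pos hM
  have i2 := Real.sin_sq_add_cos_sq (Real.pi / M)
  have e : (1 / Real.sin (Real.pi / M)) ^ 2 - 1 =
      Real.cos (Real.pi / M) ^ 2 / Real.sin (Real.pi / M) ^ 2 := by
    field_simp
    linarith
  rw [norm_one_sub_mul_eq_iff (norm_dir M k) (by rw [lt_div_iff₀ hs1]; nlinarith), dir_neg, e,
    Real.tan_eq_sin_div_cos]
  congr! 4
  · congr 1; field_simp
  · field_simp

lemma norm_one_sub_even_iff {M : ℕ} (hM : 4 < M) (k : ℤ) (w : ℂ) :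
    ‖1 - (Real.cot (Real.pi / M) : ℝ) * dir M k * w‖ = ‖w‖ ↔
      ‖w - ((1 / 2 * Real.tan (2 * Real.pi / M) : ℝ) : ℂ) * dir M (-k)‖ =
        1 / 2 * Real.tan (Real.pi / M) * Real.tan (2 * Real.pi / M) := by
  have hs1 := sin_angle_pos hM.le
  have hc1 := cos_angle_pos hM.le
  have hpos := angle_pos (M := M) (by omega)
  have hlt : Real.pi / M < Real.pi / 4 := by
    have : (4 : ℝ) < M := by exact_mod_cast hM
    have := Real.pi_pos
    gcongr
  have hc2 : 0 < Real.cos (2 * (Real.pi / M)) :=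
    Real.cos_pos_of_mem_Ioo ⟨by linarith [Real.pi_pos], by linarith⟩
  have i2 := Real.sin_sq_add_cos_sq (Real.pi / M)
  have hcos2 := Real.cos_two_mul (Real.pi / M)
  have e : Real.cot (Real.pi / M) ^ 2 - 1 =
      Real.cos (2 * (Real.pi / M)) / Real.sin (Real.pi / M) ^ 2 := by
    rw [Real.cot_eq_cos_div_sin, hcos2]
    field_simp
    linarith
  have hgt : 1 < Real.cot (Real.pi / M) := by
    have : 0 < Real.cot (Real.pi / M) ^ 2 - 1 := by rw [e]; positivity
    nlinarith [one_le_cot_angle hM.le]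
  rw [norm_one_sub_mul_eq_iff (norm_dir M k) hgt, dir_neg, e, mul_div_assoc,
    Real.tan_eq_sin_div_cos (2 * _), Real.tan_eq_sin_div_cos, Real.sin_two_mul,
    Real.cot_eq_cos_div_sin]
  generalize Real.cos (2 * (Real.pi / M)) = C at hc2
  have e1 : Real.cos (Real.pi / M) / Real.sin (Real.pi / M) / (C / Real.sin (Real.pi / M) ^ 2) =
      1 / 2 * (2 * Real.sin (Real.pi / M) * Real.cos (Real.pi / M) / C) := by
    field_simp
  have e2 : 1 / (C / Real.sin (Real.pi / M) ^ 2) =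
      1 / 2 * (Real.sin (Real.pi / M) / Real.cos (Real.pi / M)) *
        (2 * Real.sin (Real.pi / M) * Real.cos (Real.pi / M) / C) := by
    field_simp
  rw [e1, e2]

lemma sUnion_innerCircles {M : ℕ} (hM : 4 < M) :
    ⋃₀ innerCircles M = {w | ∃ c ∈ outerCenters M, ‖1 - c * w‖ = ‖w‖} := by
  ext w
  constructor
  · rintro ⟨C, ⟨k, hk, rfl | rfl⟩, hw⟩
    · refine ⟨_, ⟨-(2 * k + 1), Or.inr ⟨Odd.neg ⟨k, rfl⟩, rfl⟩⟩, ?_⟩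
      rw [norm_one_sub_odd_iff hM.le, neg_neg, ← oddDir_eq_dir]
      exact mem_sphere_iff_norm.1 hw
    · refine ⟨_, ⟨-(2 * k), Or.inl ⟨by simp, rfl⟩⟩, ?_⟩
      rw [norm_one_sub_even_iff hM, neg_neg, ← evenDir_eq_dir]
      exact mem_sphere_iff_norm.1 hw
  · rintro ⟨c, ⟨k, ⟨hk, rfl⟩ | ⟨hk, rfl⟩⟩, hw⟩
    · obtain ⟨j, hj, h⟩ := exists_evenDir_eq (by omega : 0 < M) hk.neg
      rw [norm_one_sub_even_iff hM, h] at hw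
      exact ⟨_, ⟨j, hj, Or.inr rfl⟩, mem_sphere_iff_norm.2 hw⟩
    · obtain ⟨j, hj, h⟩ := exists_oddDir_eq (by omega : 0 < M) hk.neg
      rw [norm_one_sub_odd_iff hM.le, h] at hw
      exact ⟨_, ⟨j, hj, Or.inl rfl⟩, mem_sphere_iff_norm.2 hw⟩

lemma dir_four_two : dir 4 2 = I := by
  simpa using dir_half (M := 4) (q := 1) rfl (by norm_num)

lemma dir_four_four : dir 4 4 = -1 := by
  rw [show (4 : ℤ) = 2 + 2 by norm_num, dir_add, dir_four_two, Complex.I_mul_I]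

lemma dir_four_six : dir 4 6 = -I := by
  rw [show (6 : ℤ) = 4 + 2 by norm_num, dir_add, dir_four_two, dir_four_four, neg_one_mul]

lemma exists_even_dir_four_iff (w : ℂ) :
    (∃ k : ℤ, Even k ∧ (dir 4 k * w).re = 1 / 2) ↔
      w.re = 1 / 2 ∨ w.re = -(1 / 2) ∨ w.im = 1 / 2 ∨ w.im = -(1 / 2) := by
  constructor
  · rintro ⟨k, hk, h⟩
    obtain ⟨j, hj, hd⟩ := exists_evenDir_eq (M := 4) (by norm_num) hk
    rw [hd, evenDir_eq_dir] at h
    interval_cases j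
    · norm_num [dir_zero] at h
      left; linarith
    · norm_num [dir_four_two] at h
      right; right; right; linarith
    · norm_num [dir_four_four] at h
      right; left; linarith
    · norm_num [dir_four_six] at h
      right; right; left; linarith
  · rintro (h | h | h | h)
    · exact ⟨0, by decide, by rw [dir_zero, one_mul, h]⟩
    · exact ⟨4, by decide, by rw [dir_four_four, neg_one_mul, Complex.neg_re, h, neg_neg]⟩
    · exact ⟨6, by decide, by
        rw [dir_four_six, neg_mul, Complex.neg_re, Complex.I_mul_re, h, neg_neg]⟩
    · exact ⟨2, by decide, by rw [dir_four_two, Complex.I_mul_re, h, neg_neg]⟩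

lemma sUnion_innerCurvesFour :
    ⋃₀ innerCurvesFour = {w | ∃ c ∈ outerCenters 4, ‖1 - c * w‖ = ‖w‖} := by
  have e1 : Real.sin (Real.pi / (4 : ℕ)) = √2 / 2 := by push_cast; exact Real.sin_pi_div_four
  have e4 : Real.cos (Real.pi / (4 : ℕ)) = √2 / 2 := by push_cast; exact Real.cos_pi_div_four
  have hsq := Real.mul_self_sqrt (show (0 : ℝ) ≤ 2 by norm_num)
  have hpos : 0 < √2 := by positivity
  have hodd : ∀ k w, ‖1 - (1 / Real.sin (Real.pi / (4 : ℕ)) : ℝ) * dir 4 k * w‖ = ‖w‖ ↔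
      ‖w - ((√2 : ℝ) : ℂ) * dir 4 (-k)‖ = 1 := by
    intro k w
    have e5 : 1 / (√2 / 2) = √2 := by field_simp; linarith
    rw [norm_one_sub_odd_iff (by norm_num), Real.tan_eq_sin_div_cos, e1, e4,
      div_self (by positivity), mul_one, one_pow, e5]
  have heven : ∀ k w, ‖1 - (Real.cot (Real.pi / (4 : ℕ)) : ℝ) * dir 4 k * w‖ = ‖w‖ ↔
      (dir 4 k * w).re = 1 / 2 := by
    intro k w
    rw [Real.cot_eq_cos_div_sin, e1, e4, div_self (by positivity), Complex.ofReal_one, one_mul,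
      ← norm_one_sub_eq_iff_re, norm_mul, norm_dir, one_mul]
  have hlines : ∀ w : ℂ, (w.re = 1 / 2 ∨ w.re = -(1 / 2) ∨ w.im = 1 / 2 ∨ w.im = -(1 / 2)) ↔
      w ∈ ⋃₀ ({{z : ℂ | z.re = 1 / 2}, {z : ℂ | z.re = -(1 / 2)},
        {z : ℂ | z.im = 1 / 2}, {z : ℂ | z.im = -(1 / 2)}} : Set (Set ℂ)) := by
    intro w
    simp
  ext w
  unfold innerCurvesFour
  rw [Set.sUnion_union, Set.mem_union, ← hlines, ← exists_even_dir_four_iff]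
  constructor
  · rintro (⟨C, ⟨k, hk, rfl⟩, hw⟩ | ⟨k, hk, hw⟩)
    · refine ⟨_, ⟨-(2 * k + 1), Or.inr ⟨Odd.neg ⟨k, rfl⟩, rfl⟩⟩, ?_⟩
      rw [hodd, neg_neg, ← oddDir_eq_dir]
      exact mem_sphere_iff_norm.1 hw
    · exact ⟨_, ⟨k, Or.inl ⟨hk, rfl⟩⟩, (heven k w).2 hw⟩
  · rintro ⟨c, ⟨k, ⟨hk, rfl⟩ | ⟨hk, rfl⟩⟩, hw⟩
    · exact Or.inr ⟨k, hk, (heven k w).1 hw⟩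
    · obtain ⟨j, hj, h⟩ := exists_oddDir_eq (M := 4) (by norm_num) hk.neg
      rw [hodd, h] at hw
      exact Or.inl ⟨_, ⟨j, hj, rfl⟩, mem_sphere_iff_norm.2 hw⟩

lemma sUnion_innerCurves {M : ℕ} (hM : 4 ≤ M) :
    ⋃₀ (if M = 4 then innerCurvesFour else innerCircles M) =
      {w | ∃ c ∈ outerCenters M, ‖1 - c * w‖ = ‖w‖} := by
  split_ifs with h
  · rw [sUnion_innerCurvesFour, h]
  · exact sUnion_innerCircles (by omega)

/-! ### Region II as an inner envelope -/

/-- The image of `outerOpen M` under inversion, together with the origin. -/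
def innerOpen (M : ℕ) : Set ℂ :=
  {w | ‖w‖ < Real.sin (Real.pi / M) ∧ ∀ c ∈ outerCenters M, ‖w‖ < ‖1 - c * w‖}

/-- The image of `outerClosed M` under inversion, together with the origin. -/
def innerClosed (M : ℕ) : Set ℂ :=
  {w | ‖w‖ ≤ Real.sin (Real.pi / M) ∧ ∀ c ∈ outerCenters M, ‖w‖ ≤ ‖1 - c * w‖}

lemma isOpen_innerOpen {M : ℕ} (hM : 0 < M) : IsOpen (innerOpen M) := by
  have : innerOpen M = {w | ‖w‖ < Real.sin (Real.pi / M)} ∩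
      ⋂ c ∈ outerCenters M, {w | ‖w‖ < ‖1 - c * w‖} := by
    ext z; simp [innerOpen]
  rw [this]
  exact (isOpen_lt (by fun_prop) (by fun_prop)).inter
    ((finite_outerCenters hM).isOpen_biInter fun c _ => isOpen_lt (by fun_prop) (by fun_prop))

lemma isClosed_innerClosed (M : ℕ) : IsClosed (innerClosed M) := by
  have : innerClosed M = {w | ‖w‖ ≤ Real.sin (Real.pi / M)} ∩
      ⋂ c ∈ outerCenters M, {w | ‖w‖ ≤ ‖1 - c * w‖} := by
    ext z; simp [innerClosed]
  rw [this]
  exact (isClosed_le (by fun_prop) (by fun_prop)).inter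
    (isClosed_biInter fun c _ => isClosed_le (by fun_prop) (by fun_prop))

lemma innerOpen_subset_innerClosed (M : ℕ) : innerOpen M ⊆ innerClosed M :=
  fun _ h => ⟨h.1.le, fun c hc => (h.2 c hc).le⟩

lemma zero_mem_innerOpen {M : ℕ} (hM : 4 ≤ M) : 0 ∈ innerOpen M :=
  ⟨by simpa using sin_angle_pos hM, fun c _ => by simp⟩

lemma norm_one_sub_mul {c w : ℂ} (hw : w ≠ 0) : ‖1 - c * w‖ = ‖w‖ * ‖w⁻¹ - c‖ := by
  rw [← norm_mul]
  congr 1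
  field_simp

lemma mem_innerOpen_iff {M : ℕ} (hM : 4 ≤ M) {w : ℂ} (hw : w ≠ 0) :
    w ∈ innerOpen M ↔ w⁻¹ ∈ outerOpen M := by
  have hs1 := sin_angle_pos hM
  have hn := norm_pos_iff.2 hw
  unfold innerOpen outerOpen
  simp only [Set.mem_ofPred_eq, norm_inv, norm_one_sub_mul hw, one_div, inv_lt_inv₀ hs1 hn,
    lt_mul_iff_one_lt_right hn]

lemma mem_innerClosed_iff {M : ℕ} (hM : 4 ≤ M) {w : ℂ} (hw : w ≠ 0) :
    w ∈ innerClosed M ↔ w⁻¹ ∈ outerClosed M := by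
  have hs1 := sin_angle_pos hM
  have hn := norm_pos_iff.2 hw
  unfold innerClosed outerClosed
  simp only [Set.mem_ofPred_eq, norm_inv, norm_one_sub_mul hw, one_div, inv_le_inv₀ hs1 hn,
    le_mul_iff_one_le_right hn]

lemma innerClosed_eq {M : ℕ} (hM : 4 ≤ M) :
    innerClosed M = insert 0 ((fun z : ℂ => z⁻¹) '' outerClosed M) := by
  ext w
  by_cases hw : w = 0
  · subst hw
    simp [innerOpen_subset_innerClosed M (zero_mem_innerOpen hM)]
  · rw [mem_innerClosed_iff hM hw, Set.mem_insert_iff, or_iff_right hw]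
    constructor
    · exact fun h => ⟨_, h, inv_inv w⟩
    · rintro ⟨z, hz, rfl⟩
      simpa using hz

lemma mul_mem_innerOpen {M : ℕ} (hM : 4 ≤ M) {w : ℂ} (hw : w ∈ innerClosed M) {t : ℝ}
    (h0 : 0 ≤ t) (h1 : t < 1) : (t : ℂ) * w ∈ innerOpen M := by
  by_cases hw0 : w = 0
  · rw [hw0, mul_zero]
    exact zero_mem_innerOpen hM
  rcases h0.eq_or_lt with rfl | h0
  · rw [Complex.ofReal_zero, zero_mul]
    exact zero_mem_innerOpen hM
  rw [mem_innerOpen_iff hM (mul_ne_zero (by exact_mod_cast h0.ne') hw0), mul_inv,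
    ← Complex.ofReal_inv]
  exact mul_mem_outerOpen hM ((mem_innerClosed_iff hM hw0).1 hw) ((one_lt_inv₀ h0).2 h1)

lemma closure_innerOpen {M : ℕ} (hM : 4 ≤ M) : closure (innerOpen M) = innerClosed M := by
  refine (closure_minimal (innerOpen_subset_innerClosed M) (isClosed_innerClosed M)).antisymm ?_
  intro z hz
  have hlim : Filter.Tendsto (fun t : ℝ => (t : ℂ) * z) (nhdsWithin 1 (Set.Iio 1)) (nhds z) := by
    have : Continuous fun t : ℝ => (t : ℂ) * z := by fun_prop
    simpa using (this.tendsto 1).mono_left nhdsWithin_le_nhds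
  refine mem_closure_of_tendsto hlim ?_
  filter_upwards [self_mem_nhdsWithin,
    nhdsWithin_le_nhds (Ioi_mem_nhds (zero_lt_one' ℝ))] with t ht ht0
  exact mul_mem_innerOpen hM hz (Set.mem_Ioi.1 ht0).le ht

lemma isPreconnected_innerOpen {M : ℕ} (hM : 4 ≤ M) : IsPreconnected (innerOpen M) := by
  have : StarConvex ℝ 0 (innerOpen M) := by
    rw [starConvex_zero_iff]
    intro w hw t h0 h1
    rw [Complex.real_smul]
    rcases h1.eq_or_lt with rfl | h1
    · simpa using hw
    · exact mul_mem_innerOpen hM (innerOpen_subset_innerClosed M hw) h0 h1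
  exact (this.isPathConnected (zero_mem_innerOpen hM)).isConnected.isPreconnected

/-- `innerOpen` is star-shaped about the origin, hence contained in the component. It is also
relatively clopen in the complement of the curves, by inverting the sealing property of `outerOpen`.
-/
lemma connectedComponentIn_innerCurves {M : ℕ} (hM : 4 ≤ M) :
    connectedComponentIn (⋃₀ (if M = 4 then innerCurvesFour else innerCircles M))ᶜ 0 =
      innerOpen M := by
  rw [sUnion_innerCurves hM]
  have hsub : innerOpen M ⊆ {w | ∃ c ∈ outerCenters M, ‖1 - c * w‖ = ‖w‖}ᶜ := by
    rintro w hw ⟨c, hc, h⟩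
    exact (hw.2 c hc).ne' h
  have h0 := zero_mem_innerOpen hM
  refine Set.Subset.antisymm ?_
    ((isPreconnected_innerOpen hM).subset_connectedComponentIn h0 hsub)
  refine isPreconnected_connectedComponentIn.subset_of_closure_inter_subset
    (isOpen_innerOpen (by omega : 0 < M)) ⟨(0 : ℂ), ⟨mem_connectedComponentIn (hsub h0), h0⟩⟩ ?_
  rw [closure_innerOpen hM]
  rintro w ⟨hw, hwc⟩
  by_cases hw0 : w = 0
  · rwa [hw0]
  have hwc' := connectedComponentIn_subset _ _ hwc
  rw [mem_innerClosed_iff hM hw0] at hw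
  rw [mem_innerOpen_iff hM hw0]
  refine outerClosed_inter_compl_subset hM ⟨hw, ?_⟩
  rw [sUnion_outerCircles (by omega)]
  rintro ⟨c, hc, h⟩
  exact hwc' ⟨c, hc, by rw [norm_one_sub_mul hw0, h, mul_one]⟩

lemma regionII_eq {M : ℕ} (hM : 4 ≤ M) : regionII M = innerClosed M := by
  unfold regionII innerEnvelopeRegion
  rw [connectedComponentIn_innerCurves hM, closure_innerOpen hM]

/-! ### From clusterings to the separated set -/

lemma exists_injective_relayMap (M : ℕ) : ∃ N : RelayMap M, Function.Injective N := by
  have := (finite_psk M).to_subtype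
  obtain ⟨f, hf⟩ := exists_injective_nat (psk M × psk M)
  exact ⟨fun p => (f p : ℂ), Nat.cast_injective.comp hf⟩

lemma exclusiveLaw_of_injective {M : ℕ} {N : RelayMap M} (hN : Function.Injective N) :
    ExclusiveLaw N :=
  ⟨fun _ _ _ h h' => h (congrArg Prod.fst (hN h')), fun _ _ _ h h' => h (congrArg Prod.snd (hN h'))⟩

/-- The clustering that removes the singular fade state `w`: it merges exactly the pairs whose
received points coincide there. -/
lemma exclusiveLaw_add_mul (M : ℕ) {w : ℂ} (hw : w ≠ 0) :
    ExclusiveLaw (fun p : psk M × psk M => (p.1 : ℂ) + w * (p.2 : ℂ)) :=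
  ⟨fun _ _ _ h h' => h (Subtype.ext (add_right_cancel h')),
    fun _ _ _ h h' => h (Subtype.ext (mul_left_cancel₀ hw (add_left_cancel h')))⟩

lemma min_two_mul_sin {M : ℕ} (hM : 4 ≤ M) (z : ℂ) :
    min (2 * Real.sin (Real.pi / M)) (2 * ‖z‖ * Real.sin (Real.pi / M)) =
      2 * Real.sin (Real.pi / M) * min 1 ‖z‖ := by
  rw [mul_min_of_nonneg _ _ (by linarith [sin_angle_pos hM]), mul_one, mul_right_comm]

lemma sub_mem_pskDiffs {M : ℕ} (x y : psk M) : (x : ℂ) - y ∈ pskDiffs M :=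
  ⟨x, x.2, y, y.2, rfl⟩

lemma exists_psk_norm_sub_eq {M : ℕ} (h4 : 4 ∣ M) (hM : 4 ≤ M) :
    ∃ x y : psk M, x ≠ y ∧ ‖(x : ℂ) - y‖ = 2 * Real.sin (Real.pi / M) := by
  have hs1 := sin_angle_pos hM
  obtain ⟨x, hx, y, hy, h⟩ := mem_pskDiffs_of_even h4 hM (k := 0) (by simp)
  have hn : ‖x - y‖ = 2 * Real.sin (Real.pi / M) := by
    rw [← h, norm_ofReal_mul_dir _ _ (by positivity)]
  refine ⟨⟨x, hx⟩, ⟨y, hy⟩, ?_, hn⟩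
  rintro hxy
  have : x = y := congrArg Subtype.val hxy
  rw [this, sub_self, norm_zero] at hn
  linarith

lemma singularityFreeRegion_eq_separatedSet {M : ℕ} (h4 : 4 ∣ M) (hM : 4 ≤ M) :
    singularityFreeRegion M = separatedSet M := by
  ext z
  constructor
  · intro hz a ha b hb hab
    obtain ⟨N, hN⟩ := exists_injective_relayMap M
    have h := (hz N (exclusiveLaw_of_injective hN)).2
    rw [min_two_mul_sin hM] at h
    obtain ⟨x, hx, y, hy, rfl⟩ := ha
    obtain ⟨x', hx', y', hy', rfl⟩ := hb
    refine h ⟨(⟨x, hx⟩, ⟨x', hx'⟩), (⟨y, hy⟩, ⟨y', hy'⟩), fun he => ?_, rfl⟩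
    have := hN he
    simp only [Prod.mk.injEq, Subtype.mk.injEq] at this
    rcases hab with hab | hab
    · exact hab (sub_eq_zero.2 this.1)
    · exact hab (sub_eq_zero.2 this.2)
  · intro hz N hN
    obtain ⟨x, y, hxy, hn⟩ := exists_psk_norm_sub_eq h4 hM
    constructor
    -- The value is attained by adjacent signal points in one coordinate with the other coordinate
    -- fixed, a pair that no exclusive clustering can merge.
    · rcases le_total 1 ‖z‖ with h | h
      · refine ⟨(x, x), (y, x), hN.1 _ _ _ hxy, ?_⟩
        rw [min_two_mul_sin hM, min_eq_left h, mul_one]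
        simp [hn]
      · refine ⟨(x, x), (x, y), hN.2 _ _ _ hxy, ?_⟩
        rw [min_two_mul_sin hM, min_eq_right h]
        simp [hn, mul_comm]
    · rintro d ⟨p, q, hpq, rfl⟩
      rw [min_two_mul_sin hM]
      refine hz _ (sub_mem_pskDiffs _ _) _ (sub_mem_pskDiffs _ _) ?_
      by_contra! h
      exact hpq (congrArg N (Prod.ext (Subtype.ext (sub_eq_zero.1 h.1))
        (Subtype.ext (sub_eq_zero.1 h.2))))

/-! ### Generic fade states and the interior of the clustering-independent set -/

lemma normSq_add_ofReal_mul (A b : ℂ) (t : ℝ) :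
    Complex.normSq (A + t * b) =
      Complex.normSq A + t ^ 2 * Complex.normSq b + 2 * t * (A.re * b.re + A.im * b.im) := by
  simp only [Complex.normSq_apply, Complex.add_re, Complex.add_im, Complex.re_ofReal_mul,
    Complex.im_ofReal_mul]
  ring

/-- If the two norms agreed on a ball, then values and first-order terms of their squares would
agree at its centre, which forces `(a, b)` and `(a', b')` to be proportional. -/
lemma dense_norm_add_mul_ne {a b a' b' : ℂ} (h : a * b' ≠ a' * b) :
    Dense {z : ℂ | ‖a + z * b‖ ≠ ‖a' + z * b'‖} := by
  rw [← Set.compl_ofPred, ← interior_eq_empty_iff_dense_compl, Set.eq_empty_iff_forall_notMem]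
  intro w hw
  apply h
  obtain ⟨ε, hε, hball⟩ := Metric.isOpen_iff.1 isOpen_interior w hw
  have key : ∀ x : ℂ, ‖x‖ < ε →
      Complex.normSq (a + w * b + x * b) = Complex.normSq (a' + w * b' + x * b') := by
    intro x hx
    have hmem := interior_subset (hball (show w + x ∈ Metric.ball w ε by simpa using hx))
    have hmem' : ‖a + (w + x) * b‖ = ‖a' + (w + x) * b'‖ := by simpa using hmem
    rw [← Complex.sq_norm, ← Complex.sq_norm, add_assoc, add_assoc, ← add_mul, ← add_mul, hmem']
  set t : ℝ := ε / 2
  have ht : 0 < t := by positivity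
  have htn : |t| < ε := by rw [abs_of_pos ht]; exact half_lt_self hε
  have k0 := key 0 (by simpa using hε)
  have k1 := key t (by simpa using htn)
  have k2 := key (-t : ℝ) (by simpa using htn)
  have k3 := key (t * I) (by simpa using htn)
  have k4 := key ((-t : ℝ) * I) (by simpa using htn)
  rw [zero_mul, zero_mul, add_zero, add_zero] at k0
  rw [mul_assoc, mul_assoc] at k3 k4
  rw [normSq_add_ofReal_mul, normSq_add_ofReal_mul, k0] at k1 k2 k3 k4
  set A := a + w * b
  set A' := a' + w * b'
  -- Subtracting the identities for `t` and `-t` isolates the linear term; the steps along `I` do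
  -- the same for the imaginary part.
  have hre : A.re * b.re + A.im * b.im = A'.re * b'.re + A'.im * b'.im := by
    apply mul_left_cancel₀ (by positivity : 4 * t ≠ 0)
    linarith
  have him : A.re * b.im - A.im * b.re = A'.re * b'.im - A'.im * b'.re := by
    apply mul_left_cancel₀ (by positivity : 4 * t ≠ 0)
    simp only [Complex.I_mul_re, Complex.I_mul_im] at k3 k4
    linarith
  have hconj : starRingEnd ℂ A * b = starRingEnd ℂ A' * b' := by
    apply Complex.ext
    · simpa using hre
    · simp only [Complex.mul_im, Complex.conj_re, Complex.conj_im]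
      linarith
  have hAA : A * starRingEnd ℂ A = A' * starRingEnd ℂ A' := by
    rw [Complex.mul_conj, Complex.mul_conj, k0]
  have hcross : A * b' = A' * b := by
    by_cases hA : A = 0
    · have : A' = 0 := by
        rw [← Complex.normSq_eq_zero, ← k0, hA, Complex.normSq_zero]
      rw [hA, this, zero_mul, zero_mul]
    · have hc : A * starRingEnd ℂ A ≠ 0 := mul_ne_zero hA (by simpa using hA)
      apply mul_left_cancel₀ hc
      linear_combination A * b' * hAA - A * A' * hconj
  simp only [A, A'] at hcross
  linear_combination hcross

/-- Genericity is essential: at special fade states two non-proportional difference pairs may share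
a norm, so the set itself may contain stray points that the interior must exclude. -/
lemma interior_clusteringIndependentSet_subset {M : ℕ} (h4 : 4 ∣ M) (hM : 4 ≤ M)
    (hclosed : IsClosed (separatedSet M)) :
    interior (clusteringIndependentSet M) ⊆ separatedSet M := by
  have hfin : (pskDiffs M).Finite := by
    refine ((finite_psk M).image2 (fun x y => x - y) (finite_psk M)).subset ?_
    rintro _ ⟨x, hx, y, hy, rfl⟩
    exact ⟨x, hx, y, hy, rfl⟩
  let T : Set ((ℂ × ℂ) × (ℂ × ℂ)) :=
    {t | t ∈ (pskDiffs M ×ˢ pskDiffs M) ×ˢ (pskDiffs M ×ˢ pskDiffs M) ∧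
      t.1.1 * t.2.2 ≠ t.2.1 * t.1.2}
  have hT : T.Finite := ((hfin.prod hfin).prod (hfin.prod hfin)).subset fun _ h => h.1
  have hdense : Dense (⋂ t ∈ T, {z : ℂ | ‖t.1.1 + z * t.1.2‖ ≠ ‖t.2.1 + z * t.2.2‖}) :=
    dense_biInter_of_isOpen (fun t _ => isOpen_ne_fun (by fun_prop) (by fun_prop)) hT.countable
      fun t ht => dense_norm_add_mul_ne ht.2
  intro z₁ hz₁
  by_contra hz₁s
  obtain ⟨z, ⟨hzL, hzs⟩, hzT⟩ := hdense.inter_open_nonempty _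
    (isOpen_interior.inter hclosed.isOpen_compl) ⟨z₁, hz₁, hz₁s⟩
  obtain ⟨d, hd⟩ := interior_subset hzL
  obtain ⟨N, hN⟩ := exists_injective_relayMap M
  obtain ⟨⟨p, q, hpq, hdpq⟩, hlow⟩ := hd N (exclusiveLaw_of_injective hN)
  have hdlt : d < 2 * Real.sin (Real.pi / M) * min 1 ‖z‖ := by
    by_contra! hge
    apply hzs
    rintro a ⟨x, hx, y, hy, rfl⟩ b ⟨x', hx', y', hy', rfl⟩ hab
    refine hge.trans (hlow ⟨(⟨x, hx⟩, ⟨x', hx'⟩), (⟨y, hy⟩, ⟨y', hy'⟩), fun he => ?_, rfl⟩)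
    have := hN he
    simp only [Prod.mk.injEq, Subtype.mk.injEq] at this
    rcases hab with hab | hab
    · exact hab (sub_eq_zero.2 this.1)
    · exact hab (sub_eq_zero.2 this.2)
  have hs1 := sin_angle_pos hM
  have ha := sub_mem_pskDiffs p.1 q.1
  have hb := sub_mem_pskDiffs p.2 q.2
  have hab : (p.1 : ℂ) - q.1 ≠ 0 ∨ (p.2 : ℂ) - q.2 ≠ 0 := by
    by_contra! h
    exact hpq (congrArg N (Prod.ext (Subtype.ext (sub_eq_zero.1 h.1))
        (Subtype.ext (sub_eq_zero.1 h.2))))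
  set a : ℂ := p.1 - q.1
  set b : ℂ := p.2 - q.2
  -- If one difference vanished, the distance could not fall below the separation bound; so `-a/b`
  -- is a nonzero fade state.
  have ha0 : a ≠ 0 := by
    intro h0
    have hb' := le_norm_of_mem_pskDiffs h4 hM hb (hab.resolve_left (not_not.2 h0))
    rw [h0, zero_add, norm_mul] at hdpq
    have h1 : 2 * Real.sin (Real.pi / M) * min 1 ‖z‖ ≤ ‖b‖ * ‖z‖ := by
      gcongr
      exact min_le_right _ _
    linarith
  have hb0 : b ≠ 0 := by
    intro h0
    have ha' := le_norm_of_mem_pskDiffs h4 hM ha ha0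
    rw [h0, mul_zero, add_zero] at hdpq
    have h1 : 2 * Real.sin (Real.pi / M) * min 1 ‖z‖ ≤ ‖a‖ * 1 := by
      gcongr
      exact min_le_left _ _
    linarith
  -- This clustering merges every pair proportional to `(a, b)`, yet must have the same minimum `d`,
  -- attained elsewhere.
  obtain ⟨⟨p', q', hpq', hdpq'⟩, -⟩ :=
    hd _ (exclusiveLaw_add_mul M (neg_ne_zero.2 (div_ne_zero ha0 hb0)))
  have hne : a * ((p'.2 : ℂ) - q'.2) ≠ ((p'.1 : ℂ) - q'.1) * b := by
    intro he
    apply hpq'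
    field_simp
    linear_combination -he
  refine Set.mem_iInter₂.1 hzT ((a, b), ((p'.1 : ℂ) - q'.1, (p'.2 : ℂ) - q'.2))
    ⟨⟨⟨ha, hb⟩, ⟨sub_mem_pskDiffs _ _, sub_mem_pskDiffs _ _⟩⟩, hne⟩ ?_
  rw [← hdpq, hdpq']

end

theorem theorem1 (M l : ℕ) (hl : 2 ≤ l) (hM : M = 2 ^ l) :
    singularityFreeRegion M = regionI M ∪ regionII M ∧
    closure (interior (clusteringIndependentSet M)) = regionI M ∪ regionII M ∧
    regionII M = insert 0 ((fun z : ℂ => z⁻¹) '' regionI M) := by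
  have h4 : 4 ∣ M := hM ▸ pow_dvd_pow 2 hl
  have hM4 : 4 ≤ M := Nat.le_of_dvd (hM ▸ by positivity) h4
  have hsep : separatedSet M = outerClosed M ∪ innerClosed M := by
    rw [separatedSet_eq h4 hM4, innerClosed_eq hM4]
  have hclosed : IsClosed (separatedSet M) :=
    hsep ▸ (isClosed_outerClosed M).union (isClosed_innerClosed M)
  have hsub : separatedSet M ⊆ clusteringIndependentSet M := by
    rw [← singularityFreeRegion_eq_separatedSet h4 hM4]
    exact fun z hz => ⟨_, hz⟩
  rw [singularityFreeRegion_eq_separatedSet h4 hM4, regionI_eq hM4, regionII_eq hM4, ← hsep]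
  refine ⟨rfl, Set.Subset.antisymm (closure_minimal
    (interior_clusteringIndependentSet_subset h4 hM4 hclosed) hclosed) ?_, innerClosed_eq hM4⟩
  rw [hsep] at hsub ⊢
  -- Each region is the closure of its open part, and these open parts lie in the interior of the
  -- clustering-independent set.
  rw [← closure_outerOpen hM4, ← closure_innerOpen hM4, ← closure_union]
  refine closure_mono (interior_maximal ?_
    ((isOpen_outerOpen (by omega)).union (isOpen_innerOpen (by omega))))
  exact (Set.union_subset_union (outerOpen_subset_outerClosed M)
    (innerOpen_subset_innerClosed M)).trans hsub
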